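/- Let $\mathbf{Icon}$ be the 2-category whose objects are bicategories, whose 1-cells are pseudofunctors and whose 2-cells are icons: an icon $\alpha : F \Rightarrow G$ exists only between pseudofunctors that agree on objects, and consists of 2-cells $\alpha_r : Fr \Rightarrow Gr$, natural in the 1-cell $r$ and compatible with the unit and composition constraints of $F$ and $G$. Let $\mathbf{Gray}_{icon}$ be the locally full sub-2-category of 2-categories, 2-functors and icons, with inclusion $i : \mathbf{Gray}_{icon} \hookrightarrow \mathbf{Icon}$. For a bicategory $B$, let $\mathrm{st}B$ be the 2-category with the same objects, whose 1-cells $a \to b$ are the composable strings $f_n \cdots f_1$ ($n \ge 0$) of 1-cells of $B$ from $a$ to $b$, composed by concatenation. Put $e(f_n \cdots f_1) = (\cdots(f_n * f_{n-1}) * \cdots * f_2) * f_1$, so that $e(f_1) = f_1$, and let $e$ of the empty string at $a$ be the identity $I_a$. The 2-cells of $\mathrm{st}B$ between two strings $p, q$ are the 2-cells $e(p) \Rightarrow e(q)$ of $B$, with the vertical composition of $B$, and with the horizontal composition of $B$ conjugated by the coherence isomorphisms $e(p) * e(q) \cong e(pq)$. Let $e_B : \mathrm{st}B \to B$ be the pseudofunctor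 that is the identity on objects, $e$ on 1-cells and the identity function on 2-cells, with these coherence isomorphisms as constraints. Let $f_B : B \to \mathrm{st}B$ be the pseudofunctor that is the identity on objects, sends a 1-cell to the string of length one, and is the identity function on 2-cells, with constraints represented by identity 2-cells of $B$. Theorem. The assignment $B \mapsto \mathrm{st}B$ extends to a 2-functor $\mathrm{st} : \mathbf{Icon} \to \mathbf{Gray}_{icon}$ that is left 2-adjoint to the inclusion $i$: there are 2-natural transformations $1 \Rightarrow i \circ \mathrm{st}$ (the unit), with component $f_B$ at each bicategory $B$, and $\mathrm{st} \circ i \Rightarrow 1$ (the counit), with component $e_A : \mathrm{st}A \to A$ at each 2-category $A$ (in particular this $e_A$ is a 2-functor), which satisfy the two triangle identities. -/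

import Mathlib

open CategoryTheory Bicategory

universe w w₁ w₂ w₃ v v₁ v₂ v₃ u u₁ u₂ u₃

section HomCast

variable {C : Type u} [Bicategory.{w, v} C]

/-- Transport along equalities of objects `a = a'` and `b = b'`, as a functor between hom
categories of a bicategory; it is the identity functor when both equalities are `rfl`. -/
def homCast {a a' b b' : C} (ha : a = a') (hb : b = b') : (a ⟶ b) ⥤ (a' ⟶ b') where
  obj f := Quiver.Hom.cast ha hb f
  map η := by subst ha hb; exact η
  map_id f := by subst ha hb; rfl
  map_comp η θ := by subst ha hb; rfl

theorem homCast_rfl {a b : C} (ha : a = a) (hb : b = b) (f : a ⟶ b) :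
    (homCast ha hb).obj f = f := rfl

theorem homCast_rfl_map {a b : C} (ha : a = a) (hb : b = b) {f g : a ⟶ b} (η : f ⟶ g) :
    (homCast ha hb).map η = η := rfl

theorem homCast_homCast {a a' a'' b b' b'' : C} (ha : a = a') (hb : b = b') (ha' : a' = a'')
    (hb' : b' = b'') (f : a ⟶ b) :
    (homCast ha' hb').obj ((homCast ha hb).obj f) =
      (homCast (ha.trans ha') (hb.trans hb')).obj f := by
  subst ha hb ha' hb'; rfl

theorem homCast_id {a a' : C} (ha : a = a') : (homCast ha ha).obj (𝟙 a) = 𝟙 a' := by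
  subst ha; rfl

theorem homCast_comp {a a' b b' c c' : C} (ha : a = a') (hb : b = b') (hc : c = c')
    (f : a ⟶ b) (g : b ⟶ c) :
    (homCast ha hc).obj (f ≫ g) = (homCast ha hb).obj f ≫ (homCast hb hc).obj g := by
  subst ha hb hc; rfl

theorem homCast_homCast_map {a a' a'' b b' b'' : C} (ha : a = a') (hb : b = b') (ha' : a' = a'')
    (hb' : b' = b'') {f g : a ⟶ b} (η : f ⟶ g) :
    (homCast ha' hb').map ((homCast ha hb).map η) =
      eqToHom (homCast_homCast ha hb ha' hb' f) ≫
        (homCast (ha.trans ha') (hb.trans hb')).map η ≫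
          eqToHom (homCast_homCast ha hb ha' hb' g).symm := by
  subst ha hb ha' hb'
  change η = 𝟙 f ≫ η ≫ 𝟙 g
  simp

theorem homCast_map_whiskerRight {a a' b b' c c' : C} (ha : a = a') (hb : b = b') (hc : c = c')
    {f f' : a ⟶ b} (η : f ⟶ f') (g : b ⟶ c) :
    (homCast ha hc).map (η ▷ g) = eqToHom (homCast_comp ha hb hc f g) ≫
      (homCast ha hb).map η ▷ (homCast hb hc).obj g ≫
        eqToHom (homCast_comp ha hb hc f' g).symm := by
  subst ha hb hc
  change η ▷ g = 𝟙 _ ≫ η ▷ g ≫ 𝟙 _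
  simp

theorem homCast_map_whiskerLeft {a a' b b' c c' : C} (ha : a = a') (hb : b = b') (hc : c = c')
    (f : a ⟶ b) {g g' : b ⟶ c} (η : g ⟶ g') :
    (homCast ha hc).map (f ◁ η) = eqToHom (homCast_comp ha hb hc f g) ≫
      (homCast ha hb).obj f ◁ (homCast hb hc).map η ≫
        eqToHom (homCast_comp ha hb hc f g').symm := by
  subst ha hb hc
  change f ◁ η = 𝟙 _ ≫ f ◁ η ≫ 𝟙 _
  simp

variable {D : Type u₂} [Bicategory.{w₂, v₂} D] (H : C ⥤ᵖ D)

theorem map_homCast {a a' b b' : C} (ha : a = a') (hb : b = b') (f : a ⟶ b) :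
    H.map ((homCast ha hb).obj f) =
      (homCast (congrArg H.obj ha) (congrArg H.obj hb)).obj (H.map f) := by
  subst ha hb; rfl

theorem map₂_homCast {a a' b b' : C} (ha : a = a') (hb : b = b') {f g : a ⟶ b} (η : f ⟶ g) :
    H.map₂ ((homCast ha hb).map η) = eqToHom (map_homCast H ha hb f) ≫
      (homCast (congrArg H.obj ha) (congrArg H.obj hb)).map (H.map₂ η) ≫
        eqToHom (map_homCast H ha hb g).symm := by
  subst ha hb
  change H.map₂ η = 𝟙 _ ≫ H.map₂ η ≫ 𝟙 _
  simp

theorem mapId_homCast {a a' : C} (ha : a = a') :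
    (H.mapId a').inv = eqToHom (homCast_id (congrArg H.obj ha)).symm ≫
      (homCast (congrArg H.obj ha) (congrArg H.obj ha)).map (H.mapId a).inv ≫
        eqToHom (by subst ha; rfl) := by
  subst ha
  change (H.mapId a).inv = 𝟙 _ ≫ (H.mapId a).inv ≫ 𝟙 _
  simp

theorem mapComp_homCast {a a' b b' c c' : C} (ha : a = a') (hb : b = b') (hc : c = c')
    (f : a ⟶ b) (g : b ⟶ c) :
    (H.mapComp ((homCast ha hb).obj f) ((homCast hb hc).obj g)).inv =
      eqToHom (by subst ha hb hc; rfl) ≫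
      (homCast (congrArg H.obj ha) (congrArg H.obj hc)).map (H.mapComp f g).inv ≫
        eqToHom (by subst ha hb hc; rfl) := by
  subst ha hb hc
  change (H.mapComp f g).inv = 𝟙 _ ≫ (H.mapComp f g).inv ≫ 𝟙 _
  simp

theorem homCast_congr_map {a a' b b' : C} (ha : a = a') (hb : b = b') {f g : a ⟶ b} (h : f = g) :
    (homCast ha hb).map (eqToHom h) = eqToHom (by rw [h]) := by
  subst h; simp
end HomCast

section Icons

variable {B : Type u₁} [Bicategory.{w₁, v₁} B] {C : Type u₂} [Bicategory.{w₂, v₂} C]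
  {D : Type u₃} [Bicategory.{w₃, v₃} D]

/-- An icon `F ⇒ G` between pseudofunctors: `F` and `G` agree on objects, and there are 2-cells
`F f ⇒ G f`, natural in the 1-cell `f` and compatible with the unit and composition constraints
`𝟙 ⇒ F 𝟙` and `F f ≫ F g ⇒ F (f ≫ g)`, which are the inverses of Mathlib's `mapId` and `mapComp`.
The transport `homCast` only identifies `G a` with `F a`. -/
structure IconHom (F G : B ⥤ᵖ C) where
  obj_eq (a : B) : F.obj a = G.obj a
  app {a b : B} (f : a ⟶ b) :
    F.map f ⟶ (homCast (obj_eq a).symm (obj_eq b).symm).obj (G.map f)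
  naturality {a b : B} {f g : a ⟶ b} (η : f ⟶ g) :
    F.map₂ η ≫ app g = app f ≫ (homCast (obj_eq a).symm (obj_eq b).symm).map (G.map₂ η)
  app_id (a : B) :
    (F.mapId a).inv ≫ app (𝟙 a) = eqToHom (homCast_id (obj_eq a).symm).symm ≫
      (homCast (obj_eq a).symm (obj_eq a).symm).map (G.mapId a).inv
  app_comp {a b c : B} (f : a ⟶ b) (g : b ⟶ c) :
    (F.mapComp f g).inv ≫ app (f ≫ g) =
      app f ▷ F.map g ≫ (homCast (obj_eq a).symm (obj_eq b).symm).obj (G.map f) ◁ app g ≫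
        eqToHom (homCast_comp (obj_eq a).symm (obj_eq b).symm (obj_eq c).symm
          (G.map f) (G.map g)).symm ≫
        (homCast (obj_eq a).symm (obj_eq c).symm).map (G.mapComp f g).inv

namespace IconHom

theorem ext_app {F G : B ⥤ᵖ C} {α β : IconHom F G}
    (h : ∀ {a b : B} (f : a ⟶ b), α.app f = β.app f) : α = β := by
  obtain ⟨h₁, α, _, _, _⟩ := α
  obtain ⟨h₂, β, _, _, _⟩ := β
  have : @α = @β := by funext a b f; exact h f
  subst this
  rfl

/-- The identity icon. -/
@[simps]
def id (F : B ⥤ᵖ C) : IconHom F F where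
  obj_eq _ := rfl
  app f := 𝟙 (F.map f)
  naturality η := (Category.comp_id _).trans (Category.id_comp _).symm
  app_id a := (Category.comp_id _).trans (Category.id_comp _).symm
  app_comp f g := by
    change (F.mapComp f g).inv ≫ 𝟙 (F.map (f ≫ g)) =
      𝟙 (F.map f) ▷ F.map g ≫ F.map f ◁ 𝟙 (F.map g) ≫ 𝟙 _ ≫ (F.mapComp f g).inv
    simp

theorem comp_aux {a a' a'' b b' b'' c c' c'' : C} (ha : a = a') (hb : b = b') (hc : c = c')
    (ha' : a' = a'') (hb' : b' = b'') (hc' : c' = c'') {Ff : a ⟶ b} {Fg : b ⟶ c} {Ffg : a ⟶ c}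
    {Gf : a' ⟶ b'} {Gg : b' ⟶ c'} {Gfg : a' ⟶ c'}
    {Hf : a'' ⟶ b''} {Hg : b'' ⟶ c''} {Hfg : a'' ⟶ c''} {φ : Ff ≫ Fg ⟶ Ffg} {ψ : Gf ≫ Gg ⟶ Gfg}
    {χ : Hf ≫ Hg ⟶ Hfg}
    {αf : Ff ⟶ (homCast ha.symm hb.symm).obj Gf}
    {αg : Fg ⟶ (homCast hb.symm hc.symm).obj Gg}
    {αfg : Ffg ⟶ (homCast ha.symm hc.symm).obj Gfg}
    {βf : Gf ⟶ (homCast ha'.symm hb'.symm).obj Hf}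
    {βg : Gg ⟶ (homCast hb'.symm hc'.symm).obj Hg}
    {βfg : Gfg ⟶ (homCast ha'.symm hc'.symm).obj Hfg}
    (h₁ : φ ≫ αfg = αf ▷ _ ≫ _ ◁ αg ≫ eqToHom (homCast_comp ..).symm ≫ (homCast _ _).map ψ)
    (h₂ : ψ ≫ βfg = βf ▷ _ ≫ _ ◁ βg ≫ eqToHom (homCast_comp ..).symm ≫ (homCast _ _).map χ) :
    φ ≫ αfg ≫ (homCast ha.symm hc.symm).map βfg ≫ eqToHom (homCast_homCast ..) =
      (αf ≫ (homCast ha.symm hb.symm).map βf ≫ eqToHom (homCast_homCast ..)) ▷ _ ≫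
      _ ◁ (αg ≫ (homCast hb.symm hc.symm).map βg ≫ eqToHom (homCast_homCast ..)) ≫
      eqToHom (homCast_comp ..).symm ≫
      (homCast (ha.trans ha').symm (hc.trans hc').symm).map χ := by
  subst ha hb hc ha' hb' hc'
  have key : ∀ (αf : Ff ⟶ Gf) (αg : Fg ⟶ Gg) (αfg : Ffg ⟶ Gfg) (βf : Gf ⟶ Hf) (βg : Gg ⟶ Hg)
      (βfg : Gfg ⟶ Hfg) (_ : φ ≫ αfg = αf ▷ Fg ≫ Gf ◁ αg ≫ 𝟙 _ ≫ ψ)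
      (_ : ψ ≫ βfg = βf ▷ Gg ≫ Hf ◁ βg ≫ 𝟙 _ ≫ χ),
      φ ≫ αfg ≫ βfg ≫ 𝟙 _ = (αf ≫ βf ≫ 𝟙 _) ▷ Fg ≫ Hf ◁ (αg ≫ βg ≫ 𝟙 _) ≫ 𝟙 _ ≫ χ := by
    intro αf αg αfg βf βg βfg h₁ h₂
    simp only [Category.comp_id, Category.id_comp] at h₁ h₂ ⊢
    rw [reassoc_of% h₁, h₂]
    simp [whisker_exchange_assoc]
  exact key αf αg αfg βf βg βfg h₁ h₂

/-- The vertical composite of icons. -/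
@[simps]
def comp {F G H : B ⥤ᵖ C} (α : IconHom F G) (β : IconHom G H) : IconHom F H where
  obj_eq a := (α.obj_eq a).trans (β.obj_eq a)
  app {a b} f := α.app f ≫ (homCast (α.obj_eq a).symm (α.obj_eq b).symm).map (β.app f) ≫
    eqToHom (homCast_homCast ..)
  naturality η := by
    rw [← Category.assoc, α.naturality, Category.assoc, ← Functor.map_comp_assoc, β.naturality]
    simp [homCast_homCast_map]
  app_id a := by
    rw [← Category.assoc, α.app_id, Category.assoc, ← Functor.map_comp_assoc, β.app_id]
    simp [homCast_homCast_map, homCast_congr_map]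
  app_comp {a b c} f g :=
    comp_aux (α.obj_eq a) (α.obj_eq b) (α.obj_eq c) (β.obj_eq a) (β.obj_eq b) (β.obj_eq c)
      (α.app_comp f g) (β.app_comp f g)

/-- Left whiskering of an icon, with components `α_{F f}`. -/
def whiskerLeft (F : B ⥤ᵖ C) {G H : C ⥤ᵖ D} (α : IconHom G H) :
    IconHom (F.comp G) (F.comp H) where
  obj_eq a := α.obj_eq (F.obj a)
  app f := α.app (F.map f)
  naturality η := α.naturality (F.map₂ η)
  app_id a := by
    have key : ((G.mapId (F.obj a)).inv ≫ G.map₂ (F.mapId a).inv) ≫ α.app (F.map (𝟙 a)) =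
        eqToHom (homCast_id (α.obj_eq (F.obj a)).symm).symm ≫
          (homCast (α.obj_eq (F.obj a)).symm (α.obj_eq (F.obj a)).symm).map
            ((H.mapId (F.obj a)).inv ≫ H.map₂ (F.mapId a).inv) := by
      simp [α.naturality, reassoc_of% (α.app_id (F.obj a))]
    exact key
  app_comp {a b c} f g := by
    have key : ((G.mapComp (F.map f) (F.map g)).inv ≫ G.map₂ (F.mapComp f g).inv) ≫
        α.app (F.map (f ≫ g)) =
        α.app (F.map f) ▷ G.map (F.map g) ≫
          (homCast (α.obj_eq (F.obj a)).symm (α.obj_eq (F.obj b)).symm).obj (H.map (F.map f)) ◁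
            α.app (F.map g) ≫
          eqToHom (homCast_comp ..).symm ≫
          (homCast (α.obj_eq (F.obj a)).symm (α.obj_eq (F.obj c)).symm).map
            ((H.mapComp (F.map f) (F.map g)).inv ≫ H.map₂ (F.mapComp f g).inv) := by
      simp [α.naturality, reassoc_of% (α.app_comp (F.map f) (F.map g))]
    exact key

/-- Right whiskering of an icon, with components `H (α_f)`. -/
def whiskerRight {F G : B ⥤ᵖ C} (α : IconHom F G) (H : C ⥤ᵖ D) :
    IconHom (F.comp H) (G.comp H) where
  obj_eq a := congrArg H.obj (α.obj_eq a)
  app {a b} f := H.map₂ (α.app f) ≫ eqToHom (map_homCast H _ _ (G.map f))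
  naturality {a b f g} η := by
    have key : H.map₂ (F.map₂ η) ≫ H.map₂ (α.app g) ≫ eqToHom (map_homCast H _ _ (G.map g)) =
        (H.map₂ (α.app f) ≫ eqToHom (map_homCast H _ _ (G.map f))) ≫
        (homCast (congrArg H.obj (α.obj_eq a).symm) (congrArg H.obj (α.obj_eq b).symm)).map
          (H.map₂ (G.map₂ η)) := by
      rw [← H.map₂_comp_assoc, α.naturality]
      simp [map₂_homCast]
    exact key
  app_id a := by
    have key : ((H.mapId (F.obj a)).inv ≫ H.map₂ (F.mapId a).inv) ≫
        H.map₂ (α.app (𝟙 a)) ≫ eqToHom (map_homCast H _ _ (G.map (𝟙 a))) =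
        eqToHom (homCast_id (congrArg H.obj (α.obj_eq a).symm)).symm ≫
        (homCast (congrArg H.obj (α.obj_eq a).symm) (congrArg H.obj (α.obj_eq a).symm)).map
          ((H.mapId (G.obj a)).inv ≫ H.map₂ (G.mapId a).inv) := by
      rw [Category.assoc, ← H.map₂_comp_assoc, α.app_id]
      simp [map₂_homCast, mapId_homCast H (α.obj_eq a).symm, PrelaxFunctor.map₂_eqToHom]
    exact key
  app_comp {a b c} f g := by
    have key : ((H.mapComp (F.map f) (F.map g)).inv ≫ H.map₂ (F.mapComp f g).inv) ≫
        H.map₂ (α.app (f ≫ g)) ≫ eqToHom (map_homCast H _ _ (G.map (f ≫ g))) =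
        (H.map₂ (α.app f) ≫ eqToHom (map_homCast H _ _ (G.map f))) ▷ H.map (F.map g) ≫
        (homCast (congrArg H.obj (α.obj_eq a).symm) (congrArg H.obj (α.obj_eq b).symm)).obj
          (H.map (G.map f)) ◁
          (H.map₂ (α.app g) ≫ eqToHom (map_homCast H _ _ (G.map g))) ≫
        eqToHom (homCast_comp ..).symm ≫
        (homCast (congrArg H.obj (α.obj_eq a).symm) (congrArg H.obj (α.obj_eq c).symm)).map
          ((H.mapComp (G.map f) (G.map g)).inv ≫ H.map₂ (G.mapComp f g).inv) := by
      rw [Category.assoc, ← H.map₂_comp_assoc, α.app_comp]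
      simp [map₂_homCast, PrelaxFunctor.map₂_eqToHom, mapComp_homCast,
        congr_whiskerLeft (map_homCast H (α.obj_eq a).symm (α.obj_eq b).symm (G.map f))]
    exact key

end IconHom

/-- The category of pseudofunctors `B ⥤ᵖ C` and icons between them. -/
@[reducible]
def iconCategory (B : Type u₁) [Bicategory.{w₁, v₁} B] (C : Type u₂) [Bicategory.{w₂, v₂} C] :
    Category (B ⥤ᵖ C) where
  Hom F G := IconHom F G
  id F := IconHom.id F
  comp α β := IconHom.comp α β
  id_comp {F G} α := by
    refine IconHom.ext_app fun f => ?_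
    change 𝟙 _ ≫ α.app f ≫ 𝟙 _ = α.app f
    simp
  comp_id {F G} α := by
    refine IconHom.ext_app fun {a b} f => ?_
    have key : α.app f ≫ (homCast (α.obj_eq a).symm (α.obj_eq b).symm).map (𝟙 (G.map f)) ≫ 𝟙 _ =
      α.app f := by simp
    exact key
  assoc α β γ := by
    refine IconHom.ext_app fun f => ?_
    simp [IconHom.comp, homCast_homCast_map, homCast_congr_map]

end Icons

section PseudofunctorEq

variable {B : Type u₁} [Bicategory.{w₁, v₁} B] {C : Type u₂} [Bicategory.{w₂, v₂} C]
  {D : Type u₃} [Bicategory.{w₃, v₃} D] {E : Type u} [Bicategory.{w, v} E]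

theorem pseudofunctor_eq {F G : B ⥤ᵖ C} (h : F.toPrelaxFunctor = G.toPrelaxFunctor)
    (hid : ∀ a, HEq (F.mapId a) (G.mapId a))
    (hcomp : ∀ {a b c : B} (f : a ⟶ b) (g : b ⟶ c), HEq (F.mapComp f g) (G.mapComp f g)) :
    F = G := by
  obtain ⟨P, i, c, _, _, _, _, _⟩ := F
  obtain ⟨P', i', c', _, _, _, _, _⟩ := G
  obtain rfl : P = P' := h
  obtain rfl : i = i' := funext fun a => eq_of_heq (hid a)
  have hc : @c = @c' := by
    funext a b d f g
    exact eq_of_heq (hcomp f g)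
  subst hc
  rfl

theorem pseudofunctor_id_comp (F : B ⥤ᵖ C) : (Pseudofunctor.id B).comp F = F :=
  pseudofunctor_eq rfl
    (fun a => heq_of_eq (Iso.ext (by
      change F.map₂ (𝟙 (𝟙 a)) ≫ (F.mapId a).hom = (F.mapId a).hom
      simp)))
    (fun f g => heq_of_eq (Iso.ext (by
      change F.map₂ (𝟙 (f ≫ g)) ≫ (F.mapComp f g).hom = (F.mapComp f g).hom
      simp)))

theorem pseudofunctor_comp_id (F : B ⥤ᵖ C) : F.comp (Pseudofunctor.id C) = F :=
  pseudofunctor_eq rfl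
    (fun a => heq_of_eq (Iso.ext (by
      change (F.mapId a).hom ≫ 𝟙 _ = (F.mapId a).hom
      simp)))
    (fun f g => heq_of_eq (Iso.ext (by
      change (F.mapComp f g).hom ≫ 𝟙 _ = (F.mapComp f g).hom
      simp)))

theorem pseudofunctor_assoc (F : B ⥤ᵖ C) (G : C ⥤ᵖ D) (H : D ⥤ᵖ E) :
    (F.comp G).comp H = F.comp (G.comp H) :=
  pseudofunctor_eq rfl
    (fun a => heq_of_eq (Iso.ext (by
      change H.map₂ (G.map₂ (F.mapId a).hom ≫ (G.mapId _).hom) ≫ (H.mapId _).hom =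
        H.map₂ (G.map₂ (F.mapId a).hom) ≫ H.map₂ (G.mapId _).hom ≫ (H.mapId _).hom
      simp)))
    (fun f g => heq_of_eq (Iso.ext (by
      change H.map₂ (G.map₂ (F.mapComp f g).hom ≫ (G.mapComp _ _).hom) ≫ (H.mapComp _ _).hom =
        H.map₂ (G.map₂ (F.mapComp f g).hom) ≫ H.map₂ (G.mapComp _ _).hom ≫ (H.mapComp _ _).hom
      simp)))

end PseudofunctorEq

section IconLemmas

variable {B : Type u₁} [Bicategory.{w₁, v₁} B] {C : Type u₂} [Bicategory.{w₂, v₂} C]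
  {D : Type u₃} [Bicategory.{w₃, v₃} D]

attribute [local instance] iconCategory

theorem icon_eq_conj {F F' G G' : B ⥤ᵖ C} (h : F = F') (α : IconHom F G) (β : IconHom F' G')
    (h' : G' = G) (H : ∀ {a b : B} (f : a ⟶ b), HEq (α.app f) (β.app f)) :
    α = (eqToHom h ≫ β ≫ eqToHom h' : F ⟶ G) := by
  subst h h'
  have key : (𝟙 F ≫ β ≫ 𝟙 G' : F ⟶ G') = β := by simp
  refine Eq.trans ?_ key.symm
  exact IconHom.ext_app fun f => eq_of_heq (H f)

theorem whiskerLeft_eqToHom_icon (F : B ⥤ᵖ C) {G H : C ⥤ᵖ D} (h : G = H) :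
    IconHom.whiskerLeft F (eqToHom h) =
      (eqToHom (congrArg F.comp h) : F.comp G ⟶ F.comp H) := by
  subst h
  exact IconHom.ext_app fun f => rfl

theorem whiskerRight_eqToHom_icon {F G : B ⥤ᵖ C} (h : F = G) (H : C ⥤ᵖ D) :
    IconHom.whiskerRight (eqToHom h) H =
      (eqToHom (congrArg (fun K => Pseudofunctor.comp K H) h) : F.comp H ⟶ G.comp H) := by
  subst h
  refine IconHom.ext_app fun f => ?_
  change H.map₂ (𝟙 (F.map f)) ≫ 𝟙 _ = 𝟙 _
  simp

end IconLemmas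

/-- The objects of the 2-category of icons: bicategories. -/
structure BicatIcon : Type (max (w + 1) (v + 1) (u + 1)) where
  /-- the underlying type of objects -/
  carrier : Type u
  [str : Bicategory.{w, v} carrier]

attribute [instance] BicatIcon.str

section BicatIcon

attribute [local instance] iconCategory

theorem icon_whisker_exchange {B : Type u₁} [Bicategory.{w₁, v₁} B] {C : Type u₂}
    [Bicategory.{w₂, v₂} C] {D : Type u₃} [Bicategory.{w₃, v₃} D]
    {F G : B ⥤ᵖ C} {H K : C ⥤ᵖ D} (α : IconHom F G) (β : IconHom H K) :
    (IconHom.whiskerLeft F β).comp (IconHom.whiskerRight α K) =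
      (IconHom.whiskerRight α H).comp (IconHom.whiskerLeft G β) := by
  refine IconHom.ext_app fun {a b} f => ?_
  have aux : ∀ {x x' y y' : C} (hx : x = x') (hy : y = y') (p : x ⟶ y) (q : x' ⟶ y')
      (θ : p ⟶ (homCast hx.symm hy.symm).obj q),
      β.app p ≫ (homCast (β.obj_eq x).symm (β.obj_eq y).symm).map
        (K.map₂ θ ≫ eqToHom (map_homCast K hx.symm hy.symm q)) ≫ eqToHom (homCast_homCast ..) =
      (H.map₂ θ ≫ eqToHom (map_homCast H hx.symm hy.symm q)) ≫
        (homCast (congrArg H.obj hx.symm) (congrArg H.obj hy.symm)).map (β.app q) ≫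
          eqToHom (homCast_homCast ..) := by
    intro x x' y y' hx hy p q θ
    subst hx hy
    have key : ∀ θ : p ⟶ q, β.app p ≫ (homCast (β.obj_eq x).symm (β.obj_eq y).symm).map
        (K.map₂ θ ≫ 𝟙 _) ≫ 𝟙 _ = (H.map₂ θ ≫ 𝟙 _) ≫ β.app q ≫ 𝟙 _ := by
      intro θ
      simp [β.naturality]
    exact key θ
  exact aux (α.obj_eq a) (α.obj_eq b) (F.map f) (G.map f) (α.app f)

theorem icon_comp_whiskerRight {B : Type u₁} [Bicategory.{w₁, v₁} B] {C : Type u₂}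
    [Bicategory.{w₂, v₂} C] {D : Type u₃} [Bicategory.{w₃, v₃} D]
    {F G K : B ⥤ᵖ C} (α : IconHom F G) (β : IconHom G K) (H : C ⥤ᵖ D) :
    IconHom.whiskerRight (α.comp β) H =
      (IconHom.whiskerRight α H).comp (IconHom.whiskerRight β H) := by
  refine IconHom.ext_app fun {a b} f => ?_
  have key : H.map₂ (α.app f ≫ (homCast (α.obj_eq a).symm (α.obj_eq b).symm).map (β.app f) ≫
        eqToHom (homCast_homCast ..)) ≫
        eqToHom (map_homCast H ((α.obj_eq a).trans (β.obj_eq a)).symm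
          ((α.obj_eq b).trans (β.obj_eq b)).symm (K.map f)) =
      (H.map₂ (α.app f) ≫ eqToHom (map_homCast H _ _ (G.map f))) ≫
        (homCast (congrArg H.obj (α.obj_eq a).symm) (congrArg H.obj (α.obj_eq b).symm)).map
          (H.map₂ (β.app f) ≫ eqToHom (map_homCast H _ _ (K.map f))) ≫
            eqToHom (homCast_homCast ..) := by
    simp [map₂_homCast, PrelaxFunctor.map₂_eqToHom, homCast_congr_map]
  exact key

theorem icon_whiskerRight_comp {B : Type u₁} [Bicategory.{w₁, v₁} B] {C : Type u₂}
    [Bicategory.{w₂, v₂} C] {D : Type u₃} [Bicategory.{w₃, v₃} D] {E : Type u} [Bicategory.{w, v} E]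
    {F F' : B ⥤ᵖ C} (α : IconHom F F') (G : C ⥤ᵖ D) (H : D ⥤ᵖ E) {a b : B} (f : a ⟶ b) :
    (IconHom.whiskerRight α (G.comp H)).app f =
      (IconHom.whiskerRight (IconHom.whiskerRight α G) H).app f := by
  have key : H.map₂ (G.map₂ (α.app f)) ≫
        eqToHom (map_homCast (G.comp H) (α.obj_eq a).symm (α.obj_eq b).symm (F'.map f)) =
      H.map₂ (G.map₂ (α.app f) ≫
        eqToHom (map_homCast G (α.obj_eq a).symm (α.obj_eq b).symm (F'.map f))) ≫
        eqToHom (map_homCast H _ _ (G.map (F'.map f))) := by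
    rw [H.map₂_comp, PrelaxFunctor.map₂_eqToHom, Category.assoc, eqToHom_trans]
    rfl
  exact key

/-- The 2-category `Icon` of bicategories, pseudofunctors and icons. -/
instance : Bicategory BicatIcon.{w, v, u} where
  Hom B C := B.carrier ⥤ᵖ C.carrier
  id B := Pseudofunctor.id B.carrier
  comp F G := F.comp G
  homCategory B C := iconCategory B.carrier C.carrier
  whiskerLeft F _ _ α := IconHom.whiskerLeft F α
  whiskerRight α H := IconHom.whiskerRight α H
  associator F G H := eqToIso (pseudofunctor_assoc F G H)
  leftUnitor F := eqToIso (pseudofunctor_id_comp F)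
  rightUnitor F := eqToIso (pseudofunctor_comp_id F)
  whiskerLeft_id F G := IconHom.ext_app fun f => rfl
  whiskerLeft_comp F _ _ _ α β := IconHom.ext_app fun f => rfl
  id_whiskerLeft α := icon_eq_conj (pseudofunctor_id_comp _) _ α
    (pseudofunctor_id_comp _).symm fun f => HEq.rfl
  comp_whiskerLeft F G _ _ α := icon_eq_conj (pseudofunctor_assoc _ _ _) _
    (IconHom.whiskerLeft F (IconHom.whiskerLeft G α)) (pseudofunctor_assoc _ _ _).symm
    fun f => HEq.rfl
  id_whiskerRight F H := whiskerRight_eqToHom_icon rfl H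
  comp_whiskerRight α β H := icon_comp_whiskerRight α β H
  whiskerRight_id α := icon_eq_conj (pseudofunctor_comp_id _) _ α
    (pseudofunctor_comp_id _).symm fun f => heq_of_eq (Category.comp_id _)
  whiskerRight_comp α G H := icon_eq_conj (pseudofunctor_assoc _ _ _).symm _
    (IconHom.whiskerRight (IconHom.whiskerRight α G) H) (pseudofunctor_assoc _ _ _)
    fun f => heq_of_eq (icon_whiskerRight_comp α G H f)
  whisker_assoc F _ _ α H := icon_eq_conj (pseudofunctor_assoc _ _ _) _
    (IconHom.whiskerLeft F (IconHom.whiskerRight α H)) (pseudofunctor_assoc _ _ _).symm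
    fun f => HEq.rfl
  whisker_exchange α β := icon_whisker_exchange α β
  pentagon F G H K := by
    simp only [eqToIso.hom]
    rw [whiskerRight_eqToHom_icon, whiskerLeft_eqToHom_icon]
    simp
  triangle F G := by
    simp only [eqToIso.hom]
    rw [whiskerRight_eqToHom_icon, whiskerLeft_eqToHom_icon]
    simp

/-- `Icon` is a 2-category. -/
instance : Bicategory.Strict BicatIcon.{w, v, u} where
  id_comp {B C} F := pseudofunctor_id_comp (B := B.carrier) (C := C.carrier) F
  comp_id {B C} F := pseudofunctor_comp_id (B := B.carrier) (C := C.carrier) F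
  assoc {A B C D} F G H := pseudofunctor_assoc (B := A.carrier) (C := B.carrier)
    (D := C.carrier) (E := D.carrier) F G H
  leftUnitor_eqToIso _ := rfl
  rightUnitor_eqToIso _ := rfl
  associator_eqToIso _ _ _ := rfl

end BicatIcon

section GrayIcon

/-- The objects of the 2-category `Gray_icon`: 2-categories, that is, strict bicategories. -/
structure GrayIcon : Type (max (w + 1) (v + 1) (u + 1)) extends BicatIcon.{w, v, u} where
  [strict : Bicategory.Strict carrier]

attribute [instance] GrayIcon.strict

theorem strictPseudofunctor_eq {B : Type u₁} [Bicategory.{w₁, v₁} B] {C : Type u₂}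
    [Bicategory.{w₂, v₂} C] {F G : StrictPseudofunctor B C}
    (h : F.toPseudofunctor = G.toPseudofunctor) : F = G := by
  obtain ⟨⟨F, _, _⟩, _, _⟩ := F
  obtain ⟨⟨G, _, _⟩, _, _⟩ := G
  obtain rfl : F = G := h
  rfl

/-- The pseudofunctor underlying a 2-functor, as a 1-cell of `Icon`. -/
@[reducible]
def GrayIcon.toHom {A B : GrayIcon.{w, v, u}} (F : StrictPseudofunctor A.carrier B.carrier) :
    A.toBicatIcon ⟶ B.toBicatIcon := F.toPseudofunctor

/-- The category of 2-functors between two 2-categories, and icons between them. -/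
@[reducible]
def strictIconCategory (A B : GrayIcon.{w, v, u}) :
    Category (StrictPseudofunctor A.carrier B.carrier) where
  Hom F G := GrayIcon.toHom F ⟶ GrayIcon.toHom G
  id F := 𝟙 (GrayIcon.toHom F)
  comp α β := α ≫ β
  id_comp α := Category.id_comp α
  comp_id α := Category.comp_id α
  assoc α β γ := Category.assoc α β γ

attribute [local instance] strictIconCategory

/-- An invertible icon between 2-functors is an isomorphism of 2-functors. -/
@[reducible]
def GrayIcon.isoMk {A B : GrayIcon.{w, v, u}} {F G : StrictPseudofunctor A.carrier B.carrier}
    (e : GrayIcon.toHom F ≅ GrayIcon.toHom G) : F ≅ G where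
  hom := e.hom
  inv := e.inv
  hom_inv_id := e.hom_inv_id
  inv_hom_id := e.inv_hom_id

set_option maxHeartbeats 2000000 in
/-- The 2-category `Gray_icon` of 2-categories, 2-functors and icons, with all compositions as in
`Icon`. -/
instance : Bicategory GrayIcon.{w, v, u} where
  Hom A B := StrictPseudofunctor A.carrier B.carrier
  id A := StrictPseudofunctor.id A.carrier
  comp F G := F.comp G
  homCategory A B := strictIconCategory A B
  whiskerLeft {A B C} F {G H} α := Bicategory.whiskerLeft (B := BicatIcon) (a := A.toBicatIcon)
    (b := B.toBicatIcon) (c := C.toBicatIcon) (GrayIcon.toHom F) (g := GrayIcon.toHom G)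
    (h := GrayIcon.toHom H) α
  whiskerRight {A B C F G} α H := Bicategory.whiskerRight (B := BicatIcon) (a := A.toBicatIcon)
    (b := B.toBicatIcon) (c := C.toBicatIcon) (f := GrayIcon.toHom F) (g := GrayIcon.toHom G)
    α (GrayIcon.toHom H)
  associator {A _ _ D} F G H := GrayIcon.isoMk (A := A) (B := D) (F := (F.comp G).comp H)
    (G := F.comp (G.comp H)) (α_ (GrayIcon.toHom F) (GrayIcon.toHom G) (GrayIcon.toHom H))
  leftUnitor {A B} F := GrayIcon.isoMk (A := A) (B := B)
    (F := (StrictPseudofunctor.id A.carrier).comp F) (G := F) (λ_ (GrayIcon.toHom F))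
  rightUnitor {A B} F := GrayIcon.isoMk (A := A) (B := B)
    (F := F.comp (StrictPseudofunctor.id B.carrier)) (G := F) (ρ_ (GrayIcon.toHom F))
  whiskerLeft_id F G := whiskerLeft_id (GrayIcon.toHom F) (GrayIcon.toHom G)
  whiskerLeft_comp F _ _ _ α β := whiskerLeft_comp (GrayIcon.toHom F) α β
  id_whiskerLeft α := id_whiskerLeft (B := BicatIcon) α
  comp_whiskerLeft F G _ _ α := comp_whiskerLeft (GrayIcon.toHom F) (GrayIcon.toHom G) α
  id_whiskerRight F H := id_whiskerRight (GrayIcon.toHom F) (GrayIcon.toHom H)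
  comp_whiskerRight α β H := comp_whiskerRight (B := BicatIcon) α β (GrayIcon.toHom H)
  whiskerRight_id α := whiskerRight_id (B := BicatIcon) α
  whiskerRight_comp α G H := whiskerRight_comp (B := BicatIcon) α (GrayIcon.toHom G) (GrayIcon.toHom H)
  whisker_assoc F _ _ α H :=
    whisker_assoc (B := BicatIcon) (GrayIcon.toHom F) α (GrayIcon.toHom H)
  whisker_exchange α β := whisker_exchange (B := BicatIcon) α β
  pentagon {A B C D E} F G H K :=
    pentagon (B := BicatIcon) (a := A.toBicatIcon) (b := B.toBicatIcon) (c := C.toBicatIcon)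
      (d := D.toBicatIcon) (e := E.toBicatIcon)
      (GrayIcon.toHom F) (GrayIcon.toHom G) (GrayIcon.toHom H) (GrayIcon.toHom K)
  triangle {A B C} F G := triangle (B := BicatIcon) (a := A.toBicatIcon) (b := B.toBicatIcon)
    (c := C.toBicatIcon) (GrayIcon.toHom F) (GrayIcon.toHom G)

theorem GrayIcon.toHom_eqToHom {A B : GrayIcon.{w, v, u}} {F G : A ⟶ B} (h : F = G) :
    (eqToHom h : F ⟶ G) =
      (eqToHom (congrArg GrayIcon.toHom h) : GrayIcon.toHom F ⟶ GrayIcon.toHom G) := by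
  subst h
  rfl

theorem GrayIcon.id_comp {A B : GrayIcon.{w, v, u}} (F : A ⟶ B) : 𝟙 A ≫ F = F :=
  strictPseudofunctor_eq (pseudofunctor_id_comp _)

theorem GrayIcon.comp_id {A B : GrayIcon.{w, v, u}} (F : A ⟶ B) : F ≫ 𝟙 B = F :=
  strictPseudofunctor_eq (pseudofunctor_comp_id _)

theorem GrayIcon.assoc {A B C D : GrayIcon.{w, v, u}} (F : A ⟶ B) (G : B ⟶ C) (H : C ⟶ D) :
    (F ≫ G) ≫ H = F ≫ G ≫ H :=
  strictPseudofunctor_eq (pseudofunctor_assoc _ _ _)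

/-- `Gray_icon` is a 2-category. -/
instance : Bicategory.Strict GrayIcon.{w, v, u} where
  id_comp F := GrayIcon.id_comp F
  comp_id F := GrayIcon.comp_id F
  assoc F G H := GrayIcon.assoc F G H
  leftUnitor_eqToIso F := Iso.ext (GrayIcon.toHom_eqToHom (GrayIcon.id_comp F)).symm
  rightUnitor_eqToIso F := Iso.ext (GrayIcon.toHom_eqToHom (GrayIcon.comp_id F)).symm
  associator_eqToIso F G H := Iso.ext (GrayIcon.toHom_eqToHom (GrayIcon.assoc F G H)).symm

/-- The inclusion 2-functor `Gray_icon ⥤ Icon`. -/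
def grayInclusion : StrictPseudofunctor GrayIcon.{w, v, u} BicatIcon.{w, v, u} :=
  StrictPseudofunctor.mk''
    { obj := fun A => A.toBicatIcon
      map := fun {A B} (F : A ⟶ B) => GrayIcon.toHom F
      map₂ := fun α => α
      map₂_id := fun _ => rfl
      map₂_comp := fun _ _ => rfl
      map_id := fun _ => rfl
      map_comp := fun _ _ => rfl
      map₂_whisker_left := fun _ _ _ _ =>
        ((Category.id_comp _).trans (Category.comp_id _)).symm
      map₂_whisker_right := fun _ _ =>
        ((Category.id_comp _).trans (Category.comp_id _)).symm }

end GrayIcon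

section Strings

/-- Strings of composable 1-cells from `a` to `b`: the string `f₁, …, fₙ` (in the order in which the
arrows are traversed) is `cons f₁ (… (cons fₙ nil))`. -/
inductive Str {B : Type u} [Quiver.{v} B] : B → B → Type (max u v)
  | nil (a : B) : Str a a
  | cons {a b c : B} (f : a ⟶ b) (p : Str b c) : Str a c

namespace Str

section
variable {B : Type u} [Quiver.{v} B]

/-- Concatenation. -/
def append {a b c : B} : Str a b → Str b c → Str a c
  | nil _, q => q
  | cons f p, q => cons f (append p q)

theorem append_nil {a b : B} (p : Str a b) : p.append (nil b) = p := by
  induction p with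
  | nil a => rfl
  | cons f p ih => exact congrArg (cons f) ih

theorem append_assoc {a b c d : B} (p : Str a b) (q : Str b c) (r : Str c d) :
    (p.append q).append r = p.append (q.append r) := by
  induction p with
  | nil a => rfl
  | cons f p ih => exact congrArg (cons f) (ih q)
end

variable {B : Type u} [Bicategory.{w, v} B]

/-- The composite of a string in the bicategory: `f₁ ≫ (f₂ ≫ (⋯ ≫ fₙ))`, which in applicative order
reads `((fₙ * ⋯) * f₂) * f₁`. The empty string gives the identity, and a string of length one gives
its only entry. -/
def eval {a b : B} : Str a b → (a ⟶ b)
  | nil a => 𝟙 a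
  | cons f (nil _) => f
  | cons f (cons g p) => f ≫ eval (cons g p)

/-- The coherence isomorphism between `f ≫ eval p` and the composite of `cons f p`. -/
def evalCons {a b c : B} (f : a ⟶ b) : (p : Str b c) → (f ≫ eval p ≅ eval (cons f p))
  | nil _ => ρ_ f
  | cons g p => Iso.refl (f ≫ eval (cons g p))

/-- The coherence isomorphism from the composite of two evaluated strings to the evaluation of their
concatenation, built from associators and unitors. -/
def evalAppend {a b c : B} : (p : Str a b) → (q : Str b c) →
    (eval p ≫ eval q ≅ eval (p.append q))
  | nil _, q => λ_ (eval q)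
  | cons f p, q =>
    whiskerRightIso (evalCons f p).symm (eval q) ≪≫ α_ f (eval p) (eval q) ≪≫
      whiskerLeftIso f (evalAppend p q) ≪≫ evalCons f (p.append q)

theorem eval_eqToHom_cons {a b c : B} (f : a ⟶ b) {p q : Str b c} (h : p = q) :
    (evalCons f p).hom ≫ eqToHom (congrArg (fun r => eval (cons f r)) h) =
      f ◁ eqToHom (congrArg eval h) ≫ (evalCons f q).hom := by
  subst h
  simp

theorem evalAppend_nil {a b : B} (p : Str a b) :
    (evalAppend p (nil b)).hom ≫ eqToHom (congrArg eval (append_nil p)) = (ρ_ (eval p)).hom := by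
  induction p with
  | nil a =>
    change (λ_ (𝟙 a)).hom ≫ 𝟙 _ = (ρ_ (𝟙 a)).hom
    simp [unitors_equal]
  | @cons a b c f p ih =>
    have key : ∀ m : eval p ≫ 𝟙 c ⟶ eval (p.append (nil c)),
        m ≫ eqToHom (congrArg eval (append_nil p)) = (ρ_ (eval p)).hom →
        ((evalCons f p).inv ▷ 𝟙 c ≫ (α_ f (eval p) (𝟙 c)).hom ≫
          f ◁ m ≫ (evalCons f (p.append (nil c))).hom) ≫
          eqToHom (congrArg (fun r => eval (cons f r)) (append_nil p)) =
          (ρ_ (eval (cons f p))).hom := by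
      intro m hm
      simp only [Category.assoc]
      rw [eval_eqToHom_cons, ← whiskerLeft_comp_assoc, hm]
      simp
      exact append_nil p
    exact key _ ih

theorem evalAppend_assoc {a b c d : B} (p : Str a b) (q : Str b c) (r : Str c d) :
    (evalAppend p q).hom ▷ eval r ≫ (evalAppend (p.append q) r).hom ≫
        eqToHom (congrArg eval (append_assoc p q r)) =
      (α_ (eval p) (eval q) (eval r)).hom ≫ eval p ◁ (evalAppend q r).hom ≫
        (evalAppend p (q.append r)).hom := by
  induction p with
  | nil a =>
    change (λ_ (eval q)).hom ▷ eval r ≫ (evalAppend q r).hom ≫ 𝟙 _ =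
      (α_ (𝟙 a) (eval q) (eval r)).hom ≫ 𝟙 a ◁ (evalAppend q r).hom ≫
        (λ_ (eval (q.append r))).hom
    simp
  | @cons a b c f p ih =>
    have ih := ih q
    have key : ((evalCons f p).inv ▷ eval q ≫ (α_ f (eval p) (eval q)).hom ≫
        f ◁ (evalAppend p q).hom ≫ (evalCons f (p.append q)).hom) ▷ eval r ≫
        ((evalCons f (p.append q)).inv ▷ eval r ≫ (α_ f (eval (p.append q)) (eval r)).hom ≫
          f ◁ (evalAppend (p.append q) r).hom ≫ (evalCons f ((p.append q).append r)).hom) ≫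
        eqToHom (congrArg (fun s => eval (cons f s)) (append_assoc p q r)) =
      (α_ (eval (cons f p)) (eval q) (eval r)).hom ≫ eval (cons f p) ◁ (evalAppend q r).hom ≫
        ((evalCons f p).inv ▷ eval (q.append r) ≫ (α_ f (eval p) (eval (q.append r))).hom ≫
          f ◁ (evalAppend p (q.append r)).hom ≫ (evalCons f (p.append (q.append r))).hom) := by
      simp only [Category.assoc, comp_whiskerRight]
      rw [eval_eqToHom_cons, hom_inv_whiskerRight_assoc]
      rw [whisker_exchange_assoc]
      rw [associator_naturality_right_assoc]
      rw [← whiskerLeft_comp_assoc f _ (evalAppend p (q.append r)).hom]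
      have ih' : eval p ◁ (evalAppend q r).hom ≫ (evalAppend p (q.append r)).hom =
        (α_ (eval p) (eval q) (eval r)).inv ≫ (evalAppend p q).hom ▷ eval r ≫
          (evalAppend (p.append q) r).hom ≫ eqToHom (congrArg eval (append_assoc p q r)) := by
        rw [ih]; simp
      rw [ih']
      simp
      exact append_assoc p q r
    exact key

theorem evalAppend_append {a b c d : B} (p : Str a b) (q : Str b c) (r : Str c d) :
    evalAppend (p.append q) r =
      (whiskerRightIso (evalAppend p q) (eval r)).symm ≪≫ α_ (eval p) (eval q) (eval r) ≪≫
        whiskerLeftIso (eval p) (evalAppend q r) ≪≫ evalAppend p (q.append r) ≪≫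
        eqToIso (congrArg eval (append_assoc p q r)).symm := by
  ext
  simp only [Iso.trans_hom, Iso.symm_hom, whiskerRightIso_inv, whiskerLeftIso_hom, eqToIso.hom]
  rw [← reassoc_of% (evalAppend_assoc p q r)]
  simp

theorem evalAppend_nil_eq {a b : B} (p : Str a b) :
    evalAppend p (nil b) = ρ_ (eval p) ≪≫ eqToIso (congrArg eval (append_nil p)).symm := by
  ext
  have h : (evalAppend p (nil b)).hom = ((evalAppend p (nil b)).hom ≫
    eqToHom (congrArg eval (append_nil p))) ≫ eqToHom (congrArg eval (append_nil p)).symm := by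
    simp
  rw [h, evalAppend_nil p]
  rfl

end Str

/-- The objects of the strictification `st B` of a bicategory `B`: the objects of `B`. -/
structure St (B : Type u) where
  of ::
  /-- the underlying object of `B` -/
  as : B

namespace St

variable {B : Type u} [Bicategory.{w, v} B]

/-- A 2-cell of `st B` between two strings is a 2-cell of `B` between their composites. -/
@[ext]
structure Hom₂ {a b : B} (p q : Str a b) where
  /-- the 2-cell of `B` -/
  val : p.eval ⟶ q.eval

/-- The 1-cells of `st B` are strings, composed by concatenation, with the empty string as
identity. -/
instance : CategoryStruct.{max u v} (St B) where
  Hom a b := Str a.as b.as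
  id a := Str.nil a.as
  comp p q := p.append q

/-- Vertical composition in `st B` is that of `B`. -/
@[simps]
instance homCategory (a b : St B) : Category.{w} (a ⟶ b) where
  Hom p q := Hom₂ p q
  id p := ⟨𝟙 p.eval⟩
  comp η θ := ⟨η.val ≫ θ.val⟩

@[ext]
theorem hom₂_ext {a b : St B} {p q : a ⟶ b} {η θ : p ⟶ q} (h : η.val = θ.val) : η = θ :=
  Hom₂.ext h

@[simp]
theorem eqToHom_val {a b : St B} {p q : a ⟶ b} (h : p = q) :
    (eqToHom h).val = eqToHom (congrArg Str.eval h) := by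
  subst h
  rfl

theorem evalAppend_congr {a b c : B} {p p' : Str a b} {q q' : Str b c} (h : p = p')
    (h' : q = q') :
    (Str.evalAppend p q).hom ≫ eqToHom (by rw [h, h']) =
      eqToHom (by rw [h, h']) ≫ (Str.evalAppend p' q').hom := by
  subst h h'
  simp

theorem evalAppend_conj_left {a b c : B} (p : Str a b) {q q' : Str b c} (h : q = q') :
    (Str.evalAppend p q).inv ≫ p.eval ◁ eqToHom (congrArg Str.eval h) ≫
      (Str.evalAppend p q').hom = eqToHom (by rw [h]) := by
  subst h
  simp

theorem evalAppend_conj_right {a b c : B} {p p' : Str a b} (h : p = p') (q : Str b c) :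
    (Str.evalAppend p q).inv ≫ eqToHom (congrArg Str.eval h) ▷ q.eval ≫
      (Str.evalAppend p' q).hom = eqToHom (by rw [h]) := by
  subst h
  simp

/-- Left whiskering in `st B`: that of `B`, conjugated by coherence isomorphisms. -/
def whiskerLeft {a b c : B} (p : Str a b) {q r : Str b c} (η : Hom₂ q r) :
    Hom₂ (p.append q) (p.append r) :=
  ⟨(Str.evalAppend p q).inv ≫ p.eval ◁ η.val ≫ (Str.evalAppend p r).hom⟩

/-- Right whiskering in `st B`: that of `B`, conjugated by coherence isomorphisms. -/
def whiskerRight {a b c : B} {p q : Str a b} (η : Hom₂ p q) (r : Str b c) :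
    Hom₂ (p.append r) (q.append r) :=
  ⟨(Str.evalAppend p r).inv ≫ η.val ▷ r.eval ≫ (Str.evalAppend q r).hom⟩

theorem whiskerLeft_eqToHom {a b c : St B} (p : a ⟶ b) {q r : b ⟶ c} (h : q = r) :
    whiskerLeft p (eqToHom h) = (eqToHom (congrArg (p ≫ ·) h) : p ≫ q ⟶ p ≫ r) := by
  subst h
  refine hom₂_ext ?_
  change (Str.evalAppend p q).inv ≫ Str.eval p ◁ 𝟙 (Str.eval q) ≫ (Str.evalAppend p q).hom = 𝟙 _
  simp

theorem whiskerRight_eqToHom {a b c : St B} {p q : a ⟶ b} (h : p = q) (r : b ⟶ c) :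
    whiskerRight (eqToHom h) r = (eqToHom (congrArg (· ≫ r) h) : p ≫ r ⟶ q ≫ r) := by
  subst h
  refine hom₂_ext ?_
  change (Str.evalAppend p r).inv ≫ 𝟙 (Str.eval p) ▷ (Str.eval r) ≫ (Str.evalAppend p r).hom = 𝟙 _
  simp

/-- The strictification `st B`. -/
instance : Bicategory.{w, max u v} (St B) where
  homCategory a b := homCategory a b
  whiskerLeft p _ _ η := whiskerLeft p η
  whiskerRight η r := whiskerRight η r
  associator p q r := eqToIso (Str.append_assoc p q r)
  leftUnitor p := Iso.refl p
  rightUnitor p := eqToIso (Str.append_nil p)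
  whiskerLeft_id p q := hom₂_ext (by
    change (Str.evalAppend p q).inv ≫ Str.eval p ◁ 𝟙 (Str.eval q) ≫ (Str.evalAppend p q).hom = 𝟙 _
    simp)
  whiskerLeft_comp p q r s η θ := hom₂_ext (by
    change (Str.evalAppend p q).inv ≫ Str.eval p ◁ (η.val ≫ θ.val) ≫ (Str.evalAppend p s).hom =
      ((Str.evalAppend p q).inv ≫ Str.eval p ◁ η.val ≫ (Str.evalAppend p r).hom) ≫
        ((Str.evalAppend p r).inv ≫ Str.eval p ◁ θ.val ≫ (Str.evalAppend p s).hom)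
    simp)
  id_whiskerLeft {a b p q} η := hom₂_ext (by
    change (λ_ (Str.eval p)).inv ≫ 𝟙 a.as ◁ η.val ≫ (λ_ (Str.eval q)).hom = 𝟙 _ ≫ η.val ≫ 𝟙 _
    simp)
  comp_whiskerLeft p q r r' η := hom₂_ext (by
    rw [homCategory_comp_val, homCategory_comp_val, eqToIso.hom, eqToIso.inv, eqToHom_val,
      eqToHom_val]
    change (Str.evalAppend (Str.append p q) r).inv ≫ Str.eval (Str.append p q) ◁ η.val ≫
        (Str.evalAppend (Str.append p q) r').hom = eqToHom _ ≫
      ((Str.evalAppend p (Str.append q r)).inv ≫ Str.eval p ◁ ((Str.evalAppend q r).inv ≫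
        Str.eval q ◁ η.val ≫ (Str.evalAppend q r').hom) ≫
        (Str.evalAppend p (Str.append q r')).hom) ≫ eqToHom _
    rw [Str.evalAppend_append, Str.evalAppend_append]
    simp [whisker_exchange_assoc])
  id_whiskerRight p q := hom₂_ext (by
    change (Str.evalAppend p q).inv ≫ 𝟙 (Str.eval p) ▷ (Str.eval q) ≫ (Str.evalAppend p q).hom = 𝟙 _
    simp)
  comp_whiskerRight {a b c p q r} η θ s := hom₂_ext (by
    change (Str.evalAppend p s).inv ≫ (η.val ≫ θ.val) ▷ Str.eval s ≫ (Str.evalAppend r s).hom =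
      ((Str.evalAppend p s).inv ≫ η.val ▷ Str.eval s ≫ (Str.evalAppend q s).hom) ≫
        ((Str.evalAppend q s).inv ≫ θ.val ▷ Str.eval s ≫ (Str.evalAppend r s).hom)
    simp)
  whiskerRight_id {a b p q} η := hom₂_ext (by
    rw [homCategory_comp_val, homCategory_comp_val, eqToIso.hom, eqToIso.inv, eqToHom_val,
      eqToHom_val]
    change (Str.evalAppend p (Str.nil b.as)).inv ≫ η.val ▷ 𝟙 b.as ≫
      (Str.evalAppend q (Str.nil b.as)).hom = _
    rw [Str.evalAppend_nil_eq, Str.evalAppend_nil_eq]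
    change (eqToHom (congrArg Str.eval (Str.append_nil p)) ≫ (ρ_ (Str.eval p)).inv) ≫
        η.val ▷ 𝟙 b.as ≫ (ρ_ (Str.eval q)).hom ≫
          eqToHom (congrArg Str.eval (Str.append_nil q)).symm =
      eqToHom (congrArg Str.eval (Str.append_nil p)) ≫ η.val ≫
        eqToHom (congrArg Str.eval (Str.append_nil q)).symm
    simp)
  whiskerRight_comp {a b c d p p'} η q r := hom₂_ext (by
    rw [homCategory_comp_val, homCategory_comp_val, eqToIso.hom, eqToIso.inv, eqToHom_val,
      eqToHom_val]
    change (Str.evalAppend p (Str.append q r)).inv ≫ η.val ▷ Str.eval (Str.append q r) ≫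
        (Str.evalAppend p' (Str.append q r)).hom = eqToHom _ ≫
      ((Str.evalAppend (Str.append p q) r).inv ≫ ((Str.evalAppend p q).inv ≫
        η.val ▷ Str.eval q ≫ (Str.evalAppend p' q).hom) ▷ Str.eval r ≫
        (Str.evalAppend (Str.append p' q) r).hom) ≫ eqToHom _
    rw [Str.evalAppend_append, Str.evalAppend_append]
    simp only [Iso.trans_inv, Iso.symm_inv, Iso.trans_hom, Iso.symm_hom, whiskerRightIso_hom,
      whiskerRightIso_inv, whiskerLeftIso_hom, whiskerLeftIso_inv, eqToIso.hom, eqToIso.inv,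
      comp_whiskerRight, Category.assoc, eqToHom_trans, eqToHom_trans_assoc, eqToHom_refl,
      Category.id_comp, Category.comp_id, hom_inv_whiskerRight_assoc]
    rw [associator_naturality_left_assoc, Iso.inv_hom_id_assoc, ← whisker_exchange_assoc,
      whiskerLeft_inv_hom_assoc])
  whisker_assoc p q q' η r := hom₂_ext (by
    rw [homCategory_comp_val, homCategory_comp_val, eqToIso.hom, eqToIso.inv, eqToHom_val,
      eqToHom_val]
    change (Str.evalAppend (Str.append p q) r).inv ≫ ((Str.evalAppend p q).inv ≫
        Str.eval p ◁ η.val ≫ (Str.evalAppend p q').hom) ▷ Str.eval r ≫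
        (Str.evalAppend (Str.append p q') r).hom = eqToHom _ ≫
      ((Str.evalAppend p (Str.append q r)).inv ≫ Str.eval p ◁ ((Str.evalAppend q r).inv ≫
        η.val ▷ Str.eval r ≫ (Str.evalAppend q' r).hom) ≫
        (Str.evalAppend p (Str.append q' r)).hom) ≫ eqToHom _
    rw [Str.evalAppend_append, Str.evalAppend_append]
    simp)
  whisker_exchange {a b c p q r s} η θ := hom₂_ext (by
    change ((Str.evalAppend p r).inv ≫ Str.eval p ◁ θ.val ≫ (Str.evalAppend p s).hom) ≫
        ((Str.evalAppend p s).inv ≫ η.val ▷ Str.eval s ≫ (Str.evalAppend q s).hom) =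
      ((Str.evalAppend p r).inv ≫ η.val ▷ Str.eval r ≫ (Str.evalAppend q r).hom) ≫
        ((Str.evalAppend q r).inv ≫ Str.eval q ◁ θ.val ≫ (Str.evalAppend q s).hom)
    simp [whisker_exchange_assoc])
  pentagon p q r s := by
    simp only [eqToIso.hom]
    rw [whiskerRight_eqToHom, whiskerLeft_eqToHom]
    simp
  triangle {a b c} p q := by
    simp only [eqToIso.hom]
    rw [whiskerRight_eqToHom]
    have h : ((p ≫ 𝟙 b) ≫ q : a ⟶ c) = p ≫ q := Str.append_assoc p (Str.nil b.as) q
    have key : eqToHom h ≫ (whiskerLeft p (eqToHom (rfl : q = q)) : p ≫ q ⟶ p ≫ q) =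
        eqToHom h := by
      rw [whiskerLeft_eqToHom]
      simp
    exact key

/-- The strictification is a 2-category. -/
instance : Bicategory.Strict (St B) where
  id_comp p := rfl
  comp_id p := Str.append_nil p
  assoc p q r := Str.append_assoc p q r
  leftUnitor_eqToIso _ := rfl
  rightUnitor_eqToIso _ := rfl
  associator_eqToIso _ _ _ := rfl

variable (B) in
/-- The pseudofunctor `e : st B ⥤ B`: the identity on objects, composition of strings on 1-cells, the
identity function on 2-cells. -/
def e : St B ⥤ᵖ B where
  obj a := a.as
  map p := Str.eval p
  map₂ η := η.val
  map₂_id _ := rfl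
  map₂_comp _ _ := rfl
  mapId a := Iso.refl (𝟙 a.as)
  mapComp p q := (Str.evalAppend p q).symm
  map₂_whisker_left p q r η := rfl
  map₂_whisker_right η r := rfl
  map₂_associator p q r := by
    refine (eqToHom_val (Str.append_assoc p q r)).trans ?_
    change _ = (Str.evalAppend (Str.append p q) r).inv ≫
      (Str.evalAppend p q).inv ▷ Str.eval r ≫ (α_ (Str.eval p) (Str.eval q) (Str.eval r)).hom ≫
      Str.eval p ◁ (Str.evalAppend q r).hom ≫ (Str.evalAppend p (Str.append q r)).hom
    rw [Str.evalAppend_append]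
    simp
  map₂_left_unitor {a b} p := by
    change 𝟙 _ = (λ_ (Str.eval p)).inv ≫ 𝟙 (𝟙 a.as) ▷ Str.eval p ≫ (λ_ (Str.eval p)).hom
    simp
  map₂_right_unitor {a b} p := by
    refine (eqToHom_val (Str.append_nil p)).trans ?_
    change _ = (Str.evalAppend p (Str.nil b.as)).inv ≫ Str.eval p ◁ 𝟙 (𝟙 b.as) ≫
      (ρ_ (Str.eval p)).hom
    rw [Str.evalAppend_nil_eq]
    change _ = (eqToHom (congrArg Str.eval (Str.append_nil p)) ≫ (ρ_ (Str.eval p)).inv) ≫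
      Str.eval p ◁ 𝟙 (𝟙 b.as) ≫ (ρ_ (Str.eval p)).hom
    simp

/-- The string of length one. -/
def single {a b : B} (r : a ⟶ b) : Str a b := Str.cons r (Str.nil b)

theorem evalAppend_single {a b c : B} (r : a ⟶ b) (q : b ⟶ c) :
    Str.evalAppend (single r) (single q) = Iso.refl (r ≫ q) := by
  ext
  change (ρ_ r).inv ▷ q ≫ (α_ r (𝟙 b) q).hom ≫ r ◁ (λ_ q).hom ≫ 𝟙 (r ≫ q) = 𝟙 (r ≫ q)
  simp

theorem evalAppend_single_single {a b c d : B} (r : a ⟶ b) (q : b ⟶ c) (p : c ⟶ d) :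
    Str.evalAppend (Str.cons r (single q)) (single p) = α_ r q p := by
  ext
  change 𝟙 (r ≫ q) ▷ p ≫ (α_ r q p).hom ≫ r ◁ (Str.evalAppend (single q) (single p)).hom ≫
    𝟙 (r ≫ q ≫ p) = (α_ r q p).hom
  rw [evalAppend_single]
  change 𝟙 (r ≫ q) ▷ p ≫ (α_ r q p).hom ≫ r ◁ 𝟙 (q ≫ p) ≫ 𝟙 (r ≫ q ≫ p) = (α_ r q p).hom
  simp

theorem evalAppend_single_cons {a b c d : B} (r : a ⟶ b) (q : b ⟶ c) (p : Str c d) :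
    Str.evalAppend (single r) (Str.cons q p) = Iso.refl (r ≫ Str.eval (Str.cons q p)) := by
  ext
  change (ρ_ r).inv ▷ Str.eval (Str.cons q p) ≫ (α_ r (𝟙 b) (Str.eval (Str.cons q p))).hom ≫
    r ◁ (λ_ (Str.eval (Str.cons q p))).hom ≫ 𝟙 _ = 𝟙 _
  simp

variable (B) in
/-- The pseudofunctor `f : B ⥤ st B`: the identity on objects, strings of length one on 1-cells, the
identity function on 2-cells; its constraints are given by identity 2-cells of `B`. -/
def f : B ⥤ᵖ St B where
  obj a := ⟨a⟩
  map r := single r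
  map₂ η := ⟨η⟩
  map₂_id _ := rfl
  map₂_comp _ _ := rfl
  mapId a := ⟨⟨𝟙 (𝟙 a)⟩, ⟨𝟙 (𝟙 a)⟩, hom₂_ext (Category.id_comp _), hom₂_ext (Category.id_comp _)⟩
  mapComp r q := ⟨⟨𝟙 (r ≫ q)⟩, ⟨𝟙 (r ≫ q)⟩, hom₂_ext (Category.id_comp _),
    hom₂_ext (Category.id_comp _)⟩
  map₂_whisker_left r q q' η := hom₂_ext (by
    change r ◁ η = 𝟙 (r ≫ q) ≫ ((Str.evalAppend (single r) (single q)).inv ≫ r ◁ η ≫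
      (Str.evalAppend (single r) (single q')).hom) ≫ 𝟙 (r ≫ q')
    rw [evalAppend_single, evalAppend_single]
    change r ◁ η = 𝟙 (r ≫ q) ≫ (𝟙 (r ≫ q) ≫ r ◁ η ≫ 𝟙 (r ≫ q')) ≫ 𝟙 (r ≫ q')
    simp)
  map₂_whisker_right {a b c r r'} η q := hom₂_ext (by
    change η ▷ q = 𝟙 (r ≫ q) ≫ ((Str.evalAppend (single r) (single q)).inv ≫ η ▷ q ≫
      (Str.evalAppend (single r') (single q)).hom) ≫ 𝟙 (r' ≫ q)
    rw [evalAppend_single, evalAppend_single]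
    change η ▷ q = 𝟙 (r ≫ q) ≫ (𝟙 (r ≫ q) ≫ η ▷ q ≫ 𝟙 (r' ≫ q)) ≫ 𝟙 (r' ≫ q)
    simp)
  map₂_associator r q p := hom₂_ext (by
    change (α_ r q p).hom = 𝟙 ((r ≫ q) ≫ p) ≫
      ((Str.evalAppend (single (r ≫ q)) (single p)).inv ≫ 𝟙 (r ≫ q) ▷ p ≫
        (Str.evalAppend (Str.cons r (single q)) (single p)).hom) ≫ 𝟙 (r ≫ q ≫ p) ≫
      ((Str.evalAppend (single r) (Str.cons q (single p))).inv ≫ r ◁ 𝟙 (q ≫ p) ≫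
        (Str.evalAppend (single r) (single (q ≫ p))).hom) ≫ 𝟙 (r ≫ q ≫ p)
    rw [evalAppend_single, evalAppend_single, evalAppend_single_single, evalAppend_single_cons]
    change (α_ r q p).hom = 𝟙 ((r ≫ q) ≫ p) ≫
      (𝟙 ((r ≫ q) ≫ p) ≫ 𝟙 (r ≫ q) ▷ p ≫ (α_ r q p).hom) ≫ 𝟙 (r ≫ q ≫ p) ≫
      (𝟙 (r ≫ q ≫ p) ≫ r ◁ 𝟙 (q ≫ p) ≫ 𝟙 (r ≫ q ≫ p)) ≫ 𝟙 (r ≫ q ≫ p)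
    simp)
  map₂_left_unitor {a b} r := hom₂_ext (by
    change (λ_ r).hom = 𝟙 (𝟙 a ≫ r) ≫ ((Str.evalAppend (single (𝟙 a)) (single r)).inv ≫
      𝟙 (𝟙 a) ▷ r ≫ (λ_ r).hom) ≫ 𝟙 r
    rw [evalAppend_single]
    change (λ_ r).hom = 𝟙 (𝟙 a ≫ r) ≫ (𝟙 (𝟙 a ≫ r) ≫ 𝟙 (𝟙 a) ▷ r ≫ (λ_ r).hom) ≫ 𝟙 r
    simp)
  map₂_right_unitor {a b} r := hom₂_ext (by
    change (ρ_ r).hom = 𝟙 (r ≫ 𝟙 b) ≫ ((Str.evalAppend (single r) (single (𝟙 b))).inv ≫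
      r ◁ 𝟙 (𝟙 b) ≫ (Str.evalAppend (single r) (Str.nil b)).hom) ≫ 𝟙 r
    rw [evalAppend_single, Str.evalAppend_nil_eq]
    change (ρ_ r).hom = 𝟙 (r ≫ 𝟙 b) ≫ (𝟙 (r ≫ 𝟙 b) ≫ r ◁ 𝟙 (𝟙 b) ≫ (ρ_ r).hom ≫ 𝟙 r) ≫ 𝟙 r
    simp)

end St
end Strings

section TwoDimensional

variable {C : Type u₁} [Bicategory.{w₁, v₁} C] {D : Type u₂} [Bicategory.{w₂, v₂} D]

/-- A 2-functor between 2-categories whose action on objects is the given function `o`. -/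
structure TwoFunctorExtending (o : C → D) where
  /-- the action on 1-cells -/
  map {a b : C} (f : a ⟶ b) : o a ⟶ o b
  /-- the action on 2-cells -/
  map₂ {a b : C} {f g : a ⟶ b} (η : f ⟶ g) : map f ⟶ map g
  map_id (a : C) : map (𝟙 a) = 𝟙 (o a)
  map_comp {a b c : C} (f : a ⟶ b) (g : b ⟶ c) : map (f ≫ g) = map f ≫ map g
  map₂_id {a b : C} (f : a ⟶ b) : map₂ (𝟙 f) = 𝟙 (map f)
  map₂_comp {a b : C} {f g h : a ⟶ b} (η : f ⟶ g) (θ : g ⟶ h) :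
    map₂ (η ≫ θ) = map₂ η ≫ map₂ θ
  map₂_whisker_left {a b c : C} (f : a ⟶ b) {g g' : b ⟶ c} (η : g ⟶ g') :
    map₂ (f ◁ η) = eqToHom (map_comp f g) ≫ map f ◁ map₂ η ≫ eqToHom (map_comp f g').symm
  map₂_whisker_right {a b c : C} {f f' : a ⟶ b} (η : f ⟶ f') (g : b ⟶ c) :
    map₂ (η ▷ g) = eqToHom (map_comp f g) ≫ map₂ η ▷ map g ≫ eqToHom (map_comp f' g).symm

/-- The underlying 2-functor. -/
def TwoFunctorExtending.toTwoFunctor [Bicategory.Strict C] [Bicategory.Strict D] {o : C → D}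
    (F : TwoFunctorExtending o) : StrictPseudofunctor C D :=
  StrictPseudofunctor.mk''
    { obj := o
      map := F.map
      map₂ := F.map₂
      map₂_id := F.map₂_id
      map₂_comp := F.map₂_comp
      map_id := F.map_id
      map_comp := F.map_comp
      map₂_whisker_left := F.map₂_whisker_left
      map₂_whisker_right := F.map₂_whisker_right }

/-- A (strict) 2-natural transformation between 2-functors. -/
structure TwoNatTrans (F G : StrictPseudofunctor C D) where
  /-- the components -/
  app (a : C) : F.obj a ⟶ G.obj a
  naturality {a b : C} (f : a ⟶ b) : F.map f ≫ app b = app a ≫ G.map f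
  naturality₂ {a b : C} {f g : a ⟶ b} (η : f ⟶ g) :
    F.map₂ η ▷ app b ≫ eqToHom (naturality g) = eqToHom (naturality f) ≫ app a ◁ G.map₂ η

/-- A 2-adjunction `F ⊣ G` between 2-functors: a 2-natural unit and a 2-natural counit that satisfy
the triangle identities strictly. -/
structure TwoAdjunction (F : StrictPseudofunctor C D) (G : StrictPseudofunctor D C) where
  /-- the unit -/
  unit : TwoNatTrans (StrictPseudofunctor.id C) (F.comp G)
  /-- the counit -/
  counit : TwoNatTrans (G.comp F) (StrictPseudofunctor.id D)
  left_triangle (a : C) : F.map (unit.app a) ≫ counit.app (F.obj a) = 𝟙 (F.obj a)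
  right_triangle (b : D) : unit.app (G.obj b) ≫ G.map (counit.app b) = 𝟙 (G.obj b)

end TwoDimensional

/-- The assignment `B ↦ st B` on objects of the 2-categories `Icon` and `Gray_icon`. -/
def strictification (B : BicatIcon.{w, max u v, u}) : GrayIcon.{w, max u v, u} where
  carrier := St B.carrier

/-! The pseudofunctor `e` is the identity on objects and on 2-cells, so right whiskering with `e` is
a bijection from icons `G ⇒ H` into `st C` to icons between the composites of `G` and `H` with `e`
(`St.whiskerRight_e_injective`, `St.exists_whiskerRight_e_eq`). Hence a 2-cell into a
strictification can be defined, and an equation between such 2-cells checked, after whiskering with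
`e`.

A pseudofunctor `F` acts on strings entry by entry, which preserves concatenation and is strictly
functorial in `F`. Its constraints assemble into isomorphisms `evalMap` between the evaluation of
the image string and the image of the evaluation. Conjugation by them gives the action on 2-cells,
and they are the components of an invertible icon `comparison F : st F ≫ e ≅ e ≫ F`. The coherence
behind this is `Str.evalMap_append`. For an icon `α`, `st α` is the unique icon whose whiskering
with `e` is `e ◁ α` conjugated by the comparisons. Since the comparison of a composite is the
pasting of the comparisons (`comparison_comp`), `st` preserves whiskering; the other laws on 2-cells
are immediate.

The unit is strictly natural because `evalMap` is an identity on strings of length one and the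
inverse composition constraint on strings of length two. The counit is strictly natural because for
a 2-functor between 2-categories all coherence isomorphisms are transports along equalities, so that
the comparison is an identity. One triangle identity says that evaluating a string of length one
returns its entry, the other that concatenating the one-letter strings of the entries of `p` returns
`p`. -/

/-! ### Pseudofunctors acting on strings -/

namespace Str

variable {B : Type u₁} [Bicategory.{w₁, v₁} B] {C : Type u₂} [Bicategory.{w₂, v₂} C]
  {D : Type u₃} [Bicategory.{w₃, v₃} D]

/-- The image of a string under a pseudofunctor, taken entry by entry. -/
def map (F : B ⥤ᵖ C) {a b : B} : Str a b → Str (F.obj a) (F.obj b)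
  | nil a => nil (F.obj a)
  | cons f p => cons (F.map f) (map F p)

theorem map_append (F : B ⥤ᵖ C) {a b c : B} (p : Str a b) (q : Str b c) :
    (p.append q).map F = (p.map F).append (q.map F) := by
  induction p with
  | nil a => rfl
  | cons f p ih => exact congrArg (cons (F.map f)) (ih q)

theorem map_id {a b : B} (p : Str a b) : p.map (Pseudofunctor.id B) = p := by
  induction p with
  | nil a => rfl
  | cons f p ih => exact congrArg (cons f) ih

theorem map_comp (F : B ⥤ᵖ C) (G : C ⥤ᵖ D) {a b : B} (p : Str a b) :
    p.map (F.comp G) = (p.map F).map G := by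
  induction p with
  | nil a => rfl
  | cons f p ih => exact congrArg (cons (G.map (F.map f))) ih

/-- A pseudofunctor preserves the composite of a string up to the isomorphism built from its
constraints. -/
def evalMap (F : B ⥤ᵖ C) {a b : B} : (p : Str a b) → ((p.map F).eval ≅ F.map p.eval)
  | nil a => (F.mapId a).symm
  | cons f p => (evalCons (F.map f) (p.map F)).symm ≪≫ whiskerLeftIso (F.map f) (evalMap F p) ≪≫
      (F.mapComp f p.eval).symm ≪≫ F.map₂Iso (evalCons f p)

/-- The recursion for `evalMap` ends at the empty string, so a unit constraint enters even here; the
right unit axiom of `F` removes it. -/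
theorem evalMap_single (F : B ⥤ᵖ C) {a b : B} (f : a ⟶ b) :
    (evalMap F (cons f (nil b))).hom = 𝟙 (F.map f) := by
  change (ρ_ (F.map f)).inv ≫ F.map f ◁ (F.mapId b).inv ≫ (F.mapComp f (𝟙 b)).inv ≫
    F.map₂ (ρ_ f).hom = 𝟙 (F.map f)
  simp

theorem eval_eqToHom_cons_inv {a b c : B} (f : a ⟶ b) {p q : Str b c} (h : p = q) :
    eqToHom (congrArg (fun r => eval (cons f r)) h) ≫ (evalCons f q).inv =
      (evalCons f p).inv ≫ f ◁ eqToHom (congrArg eval h) := by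
  subst h
  simp

/-- Induction on `p`: the empty string is the left unit axiom of `F`, and a further entry is the
associativity axiom. This is the composition axiom that makes `evalMap` an icon. -/
theorem evalMap_append (F : B ⥤ᵖ C) {a b c : B} (p : Str a b) (q : Str b c) :
    (evalAppend (p.map F) (q.map F)).hom ≫ eqToHom (congrArg eval (map_append F p q).symm) ≫
        (evalMap F (p.append q)).hom =
      (evalMap F p).hom ▷ (q.map F).eval ≫ F.map p.eval ◁ (evalMap F q).hom ≫
        (F.mapComp p.eval q.eval).inv ≫ F.map₂ (evalAppend p q).hom := by
  induction p with
  | nil a =>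
    change (λ_ (q.map F).eval).hom ≫ 𝟙 _ ≫ (evalMap F q).hom = (F.mapId a).inv ▷ (q.map F).eval ≫
      F.map (𝟙 a) ◁ (evalMap F q).hom ≫ (F.mapComp (𝟙 a) q.eval).inv ≫ F.map₂ (λ_ q.eval).hom
    rw [← whisker_exchange_assoc]
    simp
  | @cons a b d f p ih =>
    have ih := ih q
    have key : ((evalCons (F.map f) (p.map F)).inv ▷ (q.map F).eval ≫
        (α_ (F.map f) (p.map F).eval (q.map F).eval).hom ≫
        F.map f ◁ (evalAppend (p.map F) (q.map F)).hom ≫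
          (evalCons (F.map f) ((p.map F).append (q.map F))).hom) ≫
        eqToHom (congrArg (fun r => eval (cons (F.map f) r)) (map_append F p q).symm) ≫
        ((evalCons (F.map f) ((p.append q).map F)).inv ≫ F.map f ◁ (evalMap F (p.append q)).hom ≫
          (F.mapComp f (p.append q).eval).inv ≫ F.map₂ (evalCons f (p.append q)).hom) =
      ((evalCons (F.map f) (p.map F)).inv ≫ F.map f ◁ (evalMap F p).hom ≫
          (F.mapComp f p.eval).inv ≫ F.map₂ (evalCons f p).hom) ▷ (q.map F).eval ≫
        F.map (cons f p).eval ◁ (evalMap F q).hom ≫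
        (F.mapComp (cons f p).eval q.eval).inv ≫ F.map₂ ((evalCons f p).inv ▷ q.eval ≫
          (α_ f p.eval q.eval).hom ≫ f ◁ (evalAppend p q).hom ≫
            (evalCons f (p.append q)).hom) := by
      simp only [Category.assoc]
      rw [reassoc_of% (eval_eqToHom_cons_inv (F.map f) (map_append F p q).symm)]
      simp only [Iso.hom_inv_id_assoc, ← whiskerLeft_comp_assoc]
      rw [ih]
      simp only [comp_whiskerRight, PrelaxFunctor.map₂_comp, whiskerLeft_comp, Category.assoc]
      rw [← whisker_exchange_assoc, ← whisker_exchange_assoc]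
      -- The recursion for `evalMap` ends with `evalCons f p` and that for `evalAppend` starts with
      -- its inverse; under `F` and whiskering the two cancel.
      have cancel : ∀ {x : F.obj a ⟶ F.obj c} (m : F.map (f ≫ p.eval) ≫ F.map q.eval ⟶ x),
          F.map₂ (evalCons f p).hom ▷ F.map q.eval ≫ F.map₂ (evalCons f p).inv ▷ F.map q.eval ≫ m =
            m := fun m => by
        rw [← comp_whiskerRight_assoc, ← F.map₂_comp]
        simp
      simp [cancel]
    exact key

end Str

namespace Str

variable {B : Type u₁} [Bicategory.{w₁, v₁} B] {C : Type u₂} [Bicategory.{w₂, v₂} C]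

/-- `evalMap_append` solved for the comparison at a concatenation, so that it can be expanded by
rewriting. -/
theorem evalMap_append_eq (F : B ⥤ᵖ C) {a b c : B} (p : Str a b) (q : Str b c) :
    evalMap F (p.append q) =
      eqToIso (congrArg eval (map_append F p q)) ≪≫ (evalAppend (p.map F) (q.map F)).symm ≪≫
      whiskerRightIso (evalMap F p) (q.map F).eval ≪≫ whiskerLeftIso (F.map p.eval) (evalMap F q) ≪≫
        (F.mapComp p.eval q.eval).symm ≪≫ F.map₂Iso (evalAppend p q) := by
  ext
  simp [← evalMap_append]

end Str

/-! ### The induced 2-functor, its comparison icon, and whiskering with `e` -/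

namespace St

variable {B : Type u₁} [Bicategory.{w₁, v₁} B] {C : Type u₂} [Bicategory.{w₂, v₂} C]
  {D : Type u₃} [Bicategory.{w₃, v₃} D]

/-- The action of a pseudofunctor on 2-cells between strings. -/
def map₂ (F : B ⥤ᵖ C) {a b : B} {p q : Str a b} (η : Hom₂ p q) : Hom₂ (p.map F) (q.map F) :=
  ⟨(Str.evalMap F p).hom ≫ F.map₂ η.val ≫ (Str.evalMap F q).inv⟩

/-- The 2-functor between strictifications induced by a pseudofunctor. -/
def map (F : B ⥤ᵖ C) : StrictPseudofunctor (St B) (St C) :=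
  StrictPseudofunctor.mk''
    { obj := fun a => ⟨F.obj a.as⟩
      map := fun p => Str.map F p
      map₂ := fun η => map₂ F η
      map₂_id := fun p => hom₂_ext (by
        change (Str.evalMap F p).hom ≫ F.map₂ (𝟙 (Str.eval p)) ≫ (Str.evalMap F p).inv = 𝟙 _
        simp)
      map₂_comp := fun {_ _ p q r} η θ => hom₂_ext (by
        change (Str.evalMap F p).hom ≫ F.map₂ (η.val ≫ θ.val) ≫ (Str.evalMap F r).inv =
          ((Str.evalMap F p).hom ≫ F.map₂ η.val ≫ (Str.evalMap F q).inv) ≫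
            (Str.evalMap F q).hom ≫ F.map₂ θ.val ≫ (Str.evalMap F r).inv
        simp)
      map_id := fun _ => rfl
      map_comp := fun p q => Str.map_append F p q
      map₂_whisker_left := fun p q r η => hom₂_ext (by
        rw [homCategory_comp_val, homCategory_comp_val, eqToHom_val, eqToHom_val]
        change (Str.evalMap F (Str.append p q)).hom ≫ F.map₂ ((Str.evalAppend p q).inv ≫
            Str.eval p ◁ η.val ≫ (Str.evalAppend p r).hom) ≫
              (Str.evalMap F (Str.append p r)).inv = eqToHom _ ≫
          ((Str.evalAppend (Str.map F p) (Str.map F q)).inv ≫ (Str.map F p).eval ◁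
            ((Str.evalMap F q).hom ≫ F.map₂ η.val ≫ (Str.evalMap F r).inv) ≫
              (Str.evalAppend (Str.map F p) (Str.map F r)).hom) ≫ eqToHom _
        -- After the expansion the images of the `evalAppend` isomorphisms cancel, and interchange
        -- together with naturality of `mapComp` finishes.
        rw [Str.evalMap_append_eq, Str.evalMap_append_eq]
        simp [whisker_exchange_assoc, PrelaxFunctor.map₂_hom_inv_assoc])
      map₂_whisker_right := fun {_ _ _ p q} η r => hom₂_ext (by
        rw [homCategory_comp_val, homCategory_comp_val, eqToHom_val, eqToHom_val]
        change (Str.evalMap F (Str.append p r)).hom ≫ F.map₂ ((Str.evalAppend p r).inv ≫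
            η.val ▷ Str.eval r ≫ (Str.evalAppend q r).hom) ≫
              (Str.evalMap F (Str.append q r)).inv = eqToHom _ ≫
          ((Str.evalAppend (Str.map F p) (Str.map F r)).inv ≫
            ((Str.evalMap F p).hom ≫ F.map₂ η.val ≫ (Str.evalMap F q).inv) ▷ (Str.map F r).eval ≫
              (Str.evalAppend (Str.map F q) (Str.map F r)).hom) ≫ eqToHom _
        rw [Str.evalMap_append_eq, Str.evalMap_append_eq]
        simp [whisker_exchange_assoc, ← PrelaxFunctor.map₂_comp_assoc]) }

/-- The icon with components `eval (F p) ≅ F (eval p)`. -/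
def evalMapIcon (F : B ⥤ᵖ C) : IconHom ((map F).toPseudofunctor.comp (e C)) ((e B).comp F) where
  obj_eq _ := rfl
  app p := (Str.evalMap F p).hom
  naturality {a b p q} η := by
    change ((Str.evalMap F p).hom ≫ F.map₂ η.val ≫ (Str.evalMap F q).inv) ≫ (Str.evalMap F q).hom =
      (Str.evalMap F p).hom ≫ F.map₂ η.val
    simp
  app_id a := by
    change (𝟙 _ ≫ 𝟙 _) ≫ (F.mapId a.as).inv = 𝟙 _ ≫ (F.mapId a.as).inv ≫ F.map₂ (𝟙 (𝟙 a.as))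
    simp
  app_comp {a b c} p q := by
    have key : ((Str.evalAppend (Str.map F p) (Str.map F q)).hom ≫
        eqToHom (congrArg Str.eval (Str.map_append F p q).symm)) ≫
          (Str.evalMap F (Str.append p q)).hom =
        (Str.evalMap F p).hom ▷ (Str.map F q).eval ≫
        F.map (Str.eval p) ◁ (Str.evalMap F q).hom ≫ 𝟙 _ ≫
        (F.mapComp (Str.eval p) (Str.eval q)).inv ≫ F.map₂ (Str.evalAppend p q).hom := by
      simp [Str.evalMap_append]
    -- The composition constraint of `map F` is a transport in `St C`; `key` mentions its value in
    -- `C`.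
    rw [← eqToHom_val (B := C) (a := ⟨F.obj a.as⟩) (b := ⟨F.obj c.as⟩)
      (Str.map_append F p q).symm] at key
    exact key

/-- The inverse of `evalMapIcon`. -/
def evalMapIconInv (F : B ⥤ᵖ C) :
    IconHom ((e B).comp F) ((map F).toPseudofunctor.comp (e C)) where
  obj_eq _ := rfl
  app p := (Str.evalMap F p).inv
  naturality {a b p q} η := by
    change F.map₂ η.val ≫ (Str.evalMap F q).inv =
      (Str.evalMap F p).inv ≫ (Str.evalMap F p).hom ≫ F.map₂ η.val ≫ (Str.evalMap F q).inv
    simp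
  app_id a := by
    change ((F.mapId a.as).inv ≫ F.map₂ (𝟙 (𝟙 a.as))) ≫ (F.mapId a.as).hom = 𝟙 _ ≫ 𝟙 _ ≫ 𝟙 _
    simp
  app_comp {a b c} p q := by
    have key : ((F.mapComp (Str.eval p) (Str.eval q)).inv ≫ F.map₂ (Str.evalAppend p q).hom) ≫
          (Str.evalMap F (Str.append p q)).inv =
        (Str.evalMap F p).inv ▷ F.map (Str.eval q) ≫
        (Str.map F p).eval ◁ (Str.evalMap F q).inv ≫ 𝟙 _ ≫
        (Str.evalAppend (Str.map F p) (Str.map F q)).hom ≫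
        eqToHom (congrArg Str.eval (Str.map_append F p q).symm) := by
      rw [Str.evalMap_append_eq]
      simp [whisker_exchange_assoc, PrelaxFunctor.map₂_hom_inv_assoc]
    rw [← eqToHom_val (B := C) (a := ⟨F.obj a.as⟩) (b := ⟨F.obj c.as⟩)
      (Str.map_append F p q).symm] at key
    exact key

/-- Since `e` does nothing to 2-cells, a component of the whiskered icon is the value of the
original component followed by a transport, which is cancelled. -/
theorem whiskerRight_e_injective {G H : D ⥤ᵖ St C} {α β : IconHom G H}
    (h : IconHom.whiskerRight α (e C) = IconHom.whiskerRight β (e C)) : α = β := by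
  refine IconHom.ext_app fun {a b} f => hom₂_ext ?_
  have h₁ := congrArg (β := (G.comp (e C)).map f ⟶ (homCast (congrArg St.as (α.obj_eq a).symm)
    (congrArg St.as (α.obj_eq b).symm)).obj ((H.comp (e C)).map f)) (fun γ => γ.app f) h
  exact (cancel_mono (eqToHom (map_homCast (e C) (α.obj_eq a).symm (α.obj_eq b).symm (H.map f)))).1 h₁

theorem e_reflects_app_id {a : C} {g h : Str a a} {i : 𝟙 a ⟶ g.eval} {j : 𝟙 a ⟶ h.eval}
    {β : g.eval ⟶ h.eval} (H : (𝟙 (𝟙 a) ≫ i) ≫ β = 𝟙 (𝟙 a) ≫ 𝟙 (𝟙 a) ≫ j) :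
    i ≫ β = 𝟙 (𝟙 a) ≫ j := by
  simpa using H

/-- The composition axiom for an icon between composites with `e` yields the one in `St C`: here `u`
and `v` stand for the values of the constraints of `G` and `H`, and `evalAppend` is the constraint
of `e`. Whiskering in `St C` is conjugation by `evalAppend`, so one cancellation suffices. -/
theorem e_reflects_app_comp {a b c : C} {g₁ h₁ : Str a b} {g₂ h₂ : Str b c} {g h : Str a c}
    {u : (g₁.append g₂).eval ⟶ g.eval} {v : (h₁.append h₂).eval ⟶ h.eval}
    {β₁ : g₁.eval ⟶ h₁.eval} {β₂ : g₂.eval ⟶ h₂.eval} {β : g.eval ⟶ h.eval}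
    (H : ((Str.evalAppend g₁ g₂).hom ≫ u) ≫ β =
      β₁ ▷ g₂.eval ≫ h₁.eval ◁ β₂ ≫ 𝟙 _ ≫ (Str.evalAppend h₁ h₂).hom ≫ v) :
    u ≫ β = ((Str.evalAppend g₁ g₂).inv ≫ β₁ ▷ g₂.eval ≫ (Str.evalAppend h₁ g₂).hom) ≫
      ((Str.evalAppend h₁ g₂).inv ≫ h₁.eval ◁ β₂ ≫ (Str.evalAppend h₁ h₂).hom) ≫ 𝟙 _ ≫ v := by
  rw [Category.assoc, ← Iso.eq_inv_comp] at H
  rw [H]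
  simp

/-- The components of `β` are already 2-cells of `St C`, and the icon axioms are reflected because
the constraints of `e` are invertible. -/
theorem exists_whiskerRight_e_eq {G H : D ⥤ᵖ St C} (β : IconHom (G.comp (e C)) (H.comp (e C))) :
    ∃ α : IconHom G H, IconHom.whiskerRight α (e C) = β := by
  obtain ⟨⟨⟨⟨G₀, G₁⟩, G₂⟩, _, _⟩, Gi, Gc, _, _, _, _, _⟩ := G
  obtain ⟨⟨⟨⟨H₀, H₁⟩, H₂⟩, _, _⟩, Hi, Hc, _, _, _, _, _⟩ := H
  -- `β` only equates the underlying objects of `C`, hence the `of`. Once the object maps coincide,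
  -- every `homCast` reduces to the identity.
  obtain rfl : G₀ = H₀ := funext fun a => congrArg of (β.obj_eq a)
  exact ⟨⟨fun _ => rfl, fun f => ⟨β.app f⟩, fun η => hom₂_ext (β.naturality η),
    fun a => hom₂_ext (e_reflects_app_id (i := (Gi a).inv.val) (j := (Hi a).inv.val)
      (β := β.app (𝟙 a)) (β.app_id a)),
    fun f g => hom₂_ext (e_reflects_app_comp (u := (Gc f g).inv.val) (v := (Hc f g).inv.val)
      (β₁ := β.app f) (β₂ := β.app g) (β := β.app (f ≫ g)) (β.app_comp f g))⟩,
    IconHom.ext_app fun f => Category.comp_id _⟩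

end St

/-! ### Equality of 2-functors -/

section Extensionality

variable {B : Type u₁} [Bicategory.{w₁, v₁} B] {C : Type u₂} [Bicategory.{w₂, v₂} C]

theorem prelaxFunctor_ext {F G : PrelaxFunctor B C} (hobj : ∀ a, F.obj a = G.obj a)
    (hmap : ∀ {a b : B} (f : a ⟶ b),
      F.map f = (homCast (hobj a).symm (hobj b).symm).obj (G.map f))
    (hmap₂ : ∀ {a b : B} {f g : a ⟶ b} (η : f ⟶ g), F.map₂ η = eqToHom (hmap f) ≫
      (homCast (hobj a).symm (hobj b).symm).map (G.map₂ η) ≫ eqToHom (hmap g).symm) : F = G := by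
  obtain ⟨⟨⟨F₀, F₁⟩, F₂⟩, _, _⟩ := F
  obtain ⟨⟨⟨G₀, G₁⟩, G₂⟩, _, _⟩ := G
  obtain rfl : F₀ = G₀ := funext hobj
  obtain rfl : @F₁ = @G₁ := by
    funext a b f
    exact hmap f
  obtain rfl : @F₂ = @G₂ := by
    funext a b f g η
    refine (hmap₂ η).trans ?_
    exact (Category.id_comp _).trans (Category.comp_id _)
  rfl

/-- The constraints of a 2-functor are transports along equalities, so they carry no further data.
-/
theorem strictPseudofunctor_ext {F G : StrictPseudofunctor B C}
    (h : F.toPrelaxFunctor = G.toPrelaxFunctor) : F = G := by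
  refine strictPseudofunctor_eq (pseudofunctor_eq h ?_ ?_)
  · obtain ⟨⟨⟨F, _, _, _, _, _, _, _⟩, _, hF⟩, _, _⟩ := F
    obtain ⟨⟨⟨G, _, _, _, _, _, _, _⟩, _, hG⟩, _, _⟩ := G
    obtain rfl : F = G := h
    exact fun a => heq_of_eq ((hF a).trans (hG a).symm)
  · obtain ⟨⟨⟨F, _, _, _, _, _, _, _⟩, _, _⟩, _, hF⟩ := F
    obtain ⟨⟨⟨G, _, _, _, _, _, _, _⟩, _, _⟩, _, hG⟩ := G
    obtain rfl : F = G := h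
    exact fun f g => heq_of_eq ((hF f g).trans (hG f g).symm)

end Extensionality

/-! ### The comparison for identities, composites and 2-functors -/

namespace Str

variable {B : Type u₁} [Bicategory.{w₁, v₁} B] {C : Type u₂} [Bicategory.{w₂, v₂} C]
  {D : Type u₃} [Bicategory.{w₃, v₃} D]

theorem evalCons_conj {a b c : B} (f : a ⟶ b) {p q : Str b c} (h : p = q) {m : p.eval ⟶ q.eval}
    (hm : m = eqToHom (congrArg eval h)) :
    (evalCons f p).inv ≫ f ◁ m ≫ (evalCons f q).hom =
      eqToHom (congrArg (fun r => eval (cons f r)) h) := by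
  subst h hm
  simp

theorem evalMap_id {a b : B} (p : Str a b) :
    (evalMap (Pseudofunctor.id B) p).hom = eqToHom (congrArg eval (map_id p)) := by
  induction p with
  | nil a => rfl
  | @cons a b c f p ih =>
    refine Eq.trans ?_ (evalCons_conj f (map_id p) ih)
    exact congrArg _ (congrArg _ (Category.id_comp _))

/-- The inductive step of `evalMap_comp`. The string `r` and the 2-cell `m` are variables so that
`h` can be substituted, which is impossible for the actual image strings. -/
theorem evalMap_comp_cons (F : B ⥤ᵖ C) (G : C ⥤ᵖ D) {a b c : B} (f : a ⟶ b) (p : Str b c)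
    {r : Str (G.obj (F.obj b)) (G.obj (F.obj c))} (h : r = (p.map F).map G)
    {m : r.eval ⟶ G.map (F.map p.eval)}
    (hm : m = eqToHom (congrArg eval h) ≫ (evalMap G (p.map F)).hom ≫ G.map₂ (evalMap F p).hom) :
    (evalCons (G.map (F.map f)) r).inv ≫ G.map (F.map f) ◁ m ≫
        ((G.mapComp (F.map f) (F.map p.eval)).inv ≫ G.map₂ (F.mapComp f p.eval).inv) ≫
        G.map₂ (F.map₂ (evalCons f p).hom) =
      eqToHom (congrArg (fun r => eval (cons (G.map (F.map f)) r)) h) ≫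
        ((evalCons (G.map (F.map f)) ((p.map F).map G)).inv ≫
          G.map (F.map f) ◁ (evalMap G (p.map F)).hom ≫
          (G.mapComp (F.map f) (p.map F).eval).inv ≫ G.map₂ (evalCons (F.map f) (p.map F)).hom) ≫
        G.map₂ ((evalCons (F.map f) (p.map F)).inv ≫ F.map f ◁ (evalMap F p).hom ≫
          (F.mapComp f p.eval).inv ≫ F.map₂ (evalCons f p).hom) := by
  subst h hm
  simp [PrelaxFunctor.map₂_hom_inv_assoc]

theorem evalMap_comp (F : B ⥤ᵖ C) (G : C ⥤ᵖ D) {a b : B} (p : Str a b) :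
    (evalMap (F.comp G) p).hom = eqToHom (congrArg eval (map_comp F G p)) ≫
      (evalMap G (p.map F)).hom ≫ G.map₂ (evalMap F p).hom := by
  induction p with
  | nil a =>
    change (G.mapId (F.obj a)).inv ≫ G.map₂ (F.mapId a).inv = 𝟙 _ ≫
      (G.mapId (F.obj a)).inv ≫ G.map₂ (F.mapId a).inv
    simp
  | cons f p ih => exact evalMap_comp_cons F G f p (map_comp F G p) ih

section

variable [Strict B]

/-- The existential form, here and in the next two lemmas, carries two facts at once: the two
1-cells are equal, and the isomorphism is the transport along that equality. -/
theorem evalCons_eq_eqToIso {a b c : B} (f : a ⟶ b) (p : Str b c) :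
    ∃ h, evalCons f p = eqToIso h := by
  cases p with
  | nil a => exact ⟨_, Strict.rightUnitor_eqToIso f⟩
  | cons g p => exact ⟨rfl, rfl⟩

theorem evalAppend_eq_eqToIso {a b c : B} (p : Str a b) (q : Str b c) :
    ∃ h, evalAppend p q = eqToIso h := by
  induction p with
  | nil a => exact ⟨_, Strict.leftUnitor_eqToIso (eval q)⟩
  | @cons a b d f p ih =>
    obtain ⟨h, ih⟩ := ih q
    obtain ⟨h₁, e₁⟩ := evalCons_eq_eqToIso f p
    obtain ⟨h₂, e₂⟩ := evalCons_eq_eqToIso f (p.append q)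
    have key : ∃ h, whiskerRightIso (evalCons f p).symm (eval q) ≪≫ α_ f (eval p) (eval q) ≪≫
      whiskerLeftIso f (evalAppend p q) ≪≫ evalCons f (p.append q) = eqToIso h := by
      rw [ih, e₁, e₂, Strict.associator_eqToIso]
      exact ⟨by rw [← h₁, Strict.assoc, h, h₂], by ext; simp⟩
    exact key

/-- Every factor in the recursion for `evalMap` is now a transport. This is what makes the counit
strictly natural. -/
theorem evalMap_eq_eqToIso [Strict C] (F : StrictPseudofunctor B C) {a b : B} (p : Str a b) :
    ∃ h, evalMap F.toPseudofunctor p = eqToIso h := by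
  induction p with
  | nil a => exact ⟨(F.map_id a).symm, congrArg Iso.symm (F.mapId_eq_eqToIso a)⟩
  | @cons a b c f p ih =>
    obtain ⟨h, ih⟩ := ih
    obtain ⟨h₁, e₁⟩ := evalCons_eq_eqToIso f p
    obtain ⟨h₂, e₂⟩ := evalCons_eq_eqToIso (F.map f) (p.map F.toPseudofunctor)
    have key : ∃ h, (evalCons (F.map f) (p.map F.toPseudofunctor)).symm ≪≫
        whiskerLeftIso (F.map f) (evalMap F.toPseudofunctor p) ≪≫
        (F.mapComp f p.eval).symm ≪≫ F.map₂Iso (evalCons f p) = eqToIso h := by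
      rw [ih, e₁, e₂, F.mapComp_eq_eqToIso]
      exact ⟨by rw [← h₂, h, ← F.map_comp, h₁], by ext; simp [PrelaxFunctor.map₂_eqToHom]⟩
    exact key

end

end Str

/-! ### Strict functoriality, naturality of `e` and `f`, and the triangle identities -/

namespace St

variable {B : Type u₁} [Bicategory.{w₁, v₁} B] {C : Type u₂} [Bicategory.{w₂, v₂} C]
  {D : Type u₃} [Bicategory.{w₃, v₃} D]

theorem comp_regroup {X : Type*} [Category X] {x₀ x₁ x₂ x₃ x₄ x₅ x₆ x₇ : X} (f₁ : x₀ ⟶ x₁)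
    (f₂ : x₁ ⟶ x₂) (f₃ : x₂ ⟶ x₃) (f₄ : x₃ ⟶ x₄) (f₅ : x₄ ⟶ x₅) (f₆ : x₅ ⟶ x₆) (f₇ : x₆ ⟶ x₇) :
    (f₁ ≫ f₂ ≫ f₃) ≫ f₄ ≫ (f₅ ≫ f₆) ≫ f₇ = f₁ ≫ (f₂ ≫ (f₃ ≫ f₄ ≫ f₅) ≫ f₆) ≫ f₇ := by
  simp

theorem eq_eqToHom_symm_of_comp_eq_id {X : Type*} [Category X] {x y : X} {i : x ⟶ y} {j : y ⟶ x}
    (h : j ≫ i = 𝟙 y) (e : x = y) (hi : i = eqToHom e) : j = eqToHom e.symm := by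
  subst e hi
  simpa using h

theorem iso_inv_eq_of_hom_eq {X : Type*} [Category X] {p q r : X} {i : p ≅ r} {j : q ≅ r} (h : p = q)
    (H : i.hom = eqToHom h ≫ j.hom) : i.inv = j.inv ≫ eqToHom h.symm := by
  subst h
  obtain rfl : i = j := Iso.ext (by simpa using H)
  simp

theorem hom₂_eq_conj {a b : St C} {p p' q q' : a ⟶ b} (hp : p = p') (hq : q = q') {η : p ⟶ q}
    {θ : p' ⟶ q'} (H : η.val = eqToHom (congrArg Str.eval hp) ≫ θ.val ≫
      eqToHom (congrArg Str.eval hq).symm) : η = eqToHom hp ≫ θ ≫ eqToHom hq.symm := by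
  subst hp hq
  refine hom₂_ext ?_
  simpa using H

theorem map_id : map (Pseudofunctor.id B) = StrictPseudofunctor.id (St B) := by
  refine strictPseudofunctor_ext (prelaxFunctor_ext (fun _ => rfl) (fun p => Str.map_id p) ?_)
  intro a b p q η
  have key : (Str.evalMap (Pseudofunctor.id B) p).hom ≫ η.val ≫
      (Str.evalMap (Pseudofunctor.id B) q).inv = eqToHom (congrArg Str.eval (Str.map_id p)) ≫
        η.val ≫ eqToHom (congrArg Str.eval (Str.map_id q)).symm := by
    have h := iso_inv_eq_of_hom_eq (i := Str.evalMap (Pseudofunctor.id B) q)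
      (j := Iso.refl q.eval) (congrArg Str.eval (Str.map_id q))
      ((Str.evalMap_id q).trans (Category.comp_id _).symm)
    rw [Str.evalMap_id, h]
    exact congrArg _ (congrArg _ (Category.id_comp _))
  exact hom₂_eq_conj (Str.map_id p) (Str.map_id q) key

/-- Both sides act entry by entry on strings; on 2-cells they conjugate by isomorphisms that, by
`Str.evalMap_comp`, differ only by transports. -/
theorem map_comp (F : B ⥤ᵖ C) (G : C ⥤ᵖ D) : map (F.comp G) = (map F).comp (map G) := by
  refine strictPseudofunctor_ext (prelaxFunctor_ext (fun _ => rfl)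
    (fun p => Str.map_comp F G p) ?_)
  intro a b p q η
  have key : (Str.evalMap (F.comp G) p).hom ≫ G.map₂ (F.map₂ η.val) ≫
      (Str.evalMap (F.comp G) q).inv = eqToHom (congrArg Str.eval (Str.map_comp F G p)) ≫
        ((Str.evalMap G (Str.map F p)).hom ≫ G.map₂ ((Str.evalMap F p).hom ≫ F.map₂ η.val ≫
          (Str.evalMap F q).inv) ≫ (Str.evalMap G (Str.map F q)).inv) ≫
            eqToHom (congrArg Str.eval (Str.map_comp F G q)).symm := by
    have h : (Str.evalMap (F.comp G) q).inv = (G.map₂ (Str.evalMap F q).inv ≫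
        (Str.evalMap G (Str.map F q)).inv) ≫ eqToHom (congrArg Str.eval (Str.map_comp F G q)).symm :=
      iso_inv_eq_of_hom_eq (i := Str.evalMap (F.comp G) q)
      (j := Str.evalMap G (Str.map F q) ≪≫ G.map₂Iso (Str.evalMap F q))
      (congrArg Str.eval (Str.map_comp F G q)) (Str.evalMap_comp F G q)
    rw [Str.evalMap_comp, h, G.map₂_comp, G.map₂_comp]
    exact comp_regroup ..
  exact hom₂_eq_conj (Str.map_comp F G p) (Str.map_comp F G q) key

variable (B) in
/-- For a 2-category, `e` is a 2-functor. -/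
def eStrict [Strict B] : StrictPseudofunctor (St B) B where
  toPseudofunctor := e B
  map_id _ := rfl
  mapId_eq_eqToIso _ := rfl
  map_comp p q := (Str.evalAppend_eq_eqToIso p q).choose.symm
  mapComp_eq_eqToIso p q :=
    congrArg Iso.symm (Str.evalAppend_eq_eqToIso p q).choose_spec

/-- For a general pseudofunctor the two sides are only related by the invertible icon `evalMapIcon`;
for a 2-functor its components are transports. -/
theorem map_comp_eStrict [Strict B] [Strict C] (F : StrictPseudofunctor B C) :
    (map F.toPseudofunctor).comp (eStrict C) = (eStrict B).comp F := by
  refine strictPseudofunctor_ext (prelaxFunctor_ext (fun _ => rfl)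
    (fun p => (Str.evalMap_eq_eqToIso F p).choose) ?_)
  intro a b p q η
  have key : (Str.evalMap F.toPseudofunctor p).hom ≫ F.map₂ η.val ≫
      (Str.evalMap F.toPseudofunctor q).inv = eqToHom (Str.evalMap_eq_eqToIso F p).choose ≫
        F.map₂ η.val ≫ eqToHom (Str.evalMap_eq_eqToIso F q).choose.symm := by
    exact congr_arg₂ (fun i j => i ≫ F.map₂ η.val ≫ j)
      (congrArg Iso.hom (Str.evalMap_eq_eqToIso F p).choose_spec)
      (congrArg Iso.inv (Str.evalMap_eq_eqToIso F q).choose_spec)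
  exact key

theorem f_comp_e : (f B).comp (e B) = Pseudofunctor.id B :=
  pseudofunctor_eq rfl (fun _ => heq_of_eq (Iso.ext (Category.comp_id _)))
    (fun r q => heq_of_eq (Iso.ext (by
      change 𝟙 (r ≫ q) ≫ (Str.evalAppend (single r) (single q)).inv = 𝟙 (r ≫ q)
      rw [evalAppend_single]
      exact Category.comp_id _)))

theorem evalMap_single (F : B ⥤ᵖ C) {a b : B} (r : a ⟶ b) :
    Str.evalMap F (single r) = Iso.refl (F.map r) :=
  Iso.ext (Str.evalMap_single F r)

theorem evalMap_pair (F : B ⥤ᵖ C) {a b c : B} (r : a ⟶ b) (q : b ⟶ c) :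
    Str.evalMap F (Str.cons r (single q)) = (F.mapComp r q).symm := by
  ext
  change 𝟙 (F.map r ≫ F.map q) ≫ F.map r ◁ (Str.evalMap F (single q)).hom ≫
    (F.mapComp r q).inv ≫ F.map₂ (𝟙 (r ≫ q)) = (F.mapComp r q).inv
  rw [evalMap_single]
  change 𝟙 (F.map r ≫ F.map q) ≫ F.map r ◁ 𝟙 (F.map q) ≫
    (F.mapComp r q).inv ≫ F.map₂ (𝟙 (r ≫ q)) = (F.mapComp r q).inv
  simp

/-- The constraints of `f` are identity 2-cells between different strings. `map F` conjugates them
by `evalMap` at strings of length zero, one and two, and this produces exactly the constraints of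
`F`. -/
theorem comp_f (F : B ⥤ᵖ C) : F.comp (f C) = (f B).comp (map F).toPseudofunctor := by
  refine pseudofunctor_eq (prelaxFunctor_ext (fun _ => rfl) (fun _ => rfl) ?_) ?_ ?_
  · intro a b r q η
    refine hom₂_eq_conj rfl rfl ?_
    change F.map₂ η = 𝟙 _ ≫ ((Str.evalMap F (single r)).hom ≫ F.map₂ η ≫
        (Str.evalMap F (single q)).inv) ≫ 𝟙 _
    rw [evalMap_single, evalMap_single]
    change F.map₂ η = 𝟙 (F.map r) ≫ (𝟙 (F.map r) ≫ F.map₂ η ≫ 𝟙 (F.map q)) ≫ 𝟙 (F.map q)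
    simp
  · intro a
    refine heq_of_eq (Iso.ext (hom₂_ext ?_))
    change (F.mapId a).hom ≫ 𝟙 (𝟙 (F.obj a)) =
      ((Str.evalMap F (single (𝟙 a))).hom ≫ F.map₂ (𝟙 (𝟙 a)) ≫ (F.mapId a).hom) ≫
        𝟙 (𝟙 (F.obj a))
    rw [evalMap_single]
    change (F.mapId a).hom ≫ 𝟙 (𝟙 (F.obj a)) =
      (𝟙 (F.map (𝟙 a)) ≫ F.map₂ (𝟙 (𝟙 a)) ≫ (F.mapId a).hom) ≫ 𝟙 (𝟙 (F.obj a))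
    simp
  · intro a b c r q
    refine heq_of_eq (Iso.ext (hom₂_ext ?_))
    change (F.mapComp r q).hom ≫ 𝟙 (F.map r ≫ F.map q) =
      ((Str.evalMap F (single (r ≫ q))).hom ≫ F.map₂ (𝟙 (r ≫ q)) ≫
        (Str.evalMap F (Str.cons r (single q))).inv) ≫ 𝟙 (F.map r ≫ F.map q)
    rw [evalMap_single, evalMap_pair]
    change (F.mapComp r q).hom ≫ 𝟙 (F.map r ≫ F.map q) =
      (𝟙 (F.map (r ≫ q)) ≫ F.map₂ (𝟙 (r ≫ q)) ≫ (F.mapComp r q).hom) ≫ 𝟙 (F.map r ≫ F.map q)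
    simp

theorem evalAppend_single_left {a b c : B} (r : a ⟶ b) (p : Str b c) :
    Str.evalAppend (single r) p = Str.evalCons r p := by
  ext
  change (ρ_ r).inv ▷ Str.eval p ≫ (α_ r (𝟙 b) (Str.eval p)).hom ≫
    r ◁ (λ_ (Str.eval p)).hom ≫ (Str.evalCons r p).hom = (Str.evalCons r p).hom
  simp

/-- Evaluation in `St B` is concatenation, and `p` is the concatenation of the one-letter strings of
its entries. -/
theorem eval_map_f {a b : B} (p : Str a b) :
    Str.eval (B := St B) (p.map (f B)) = p := by
  induction p with
  | nil a => rfl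
  | @cons a b c r p ih =>
    -- `eval` treats a string of length one separately, so the tail has to be inspected.
    cases p with
    | nil => rfl
    | cons q p => exact congrArg (Str.cons r) ih

theorem eval_eval_cons_single {a b c : B} (r : a ⟶ b) (P : Str (B := St B) ⟨b⟩ ⟨c⟩) :
    Str.eval (B := St B) (Str.cons (a := ⟨a⟩) (single r) P) =
      (Str.cons r (Str.eval (B := St B) P) : Str a c) := by
  cases P with
  | nil => rfl
  | cons => rfl

theorem evalCons_single_inv_val {a b c : B} (r : a ⟶ b) (P : Str (B := St B) ⟨b⟩ ⟨c⟩) :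
    (Str.evalCons (B := St B) (a := ⟨a⟩) (single r) P).inv.val =
      eqToHom (congrArg Str.eval (eval_eval_cons_single r P)) := by
  cases P with
  | nil => rfl
  | cons => rfl

/-- The inductive step of `evalMap_f_val`, with `p` and `s` in place of the evaluated strings of
strings so that the equalities can be substituted. -/
theorem single_conj {a b c : B} (r : a ⟶ b) {p q : Str b c} (h : p = q) {m : p.eval ⟶ q.eval}
    (hm : m = eqToHom (congrArg Str.eval h)) {s : Str a c} (hs : s = Str.cons r p) :
    eqToHom (congrArg Str.eval hs) ≫ ((Str.evalAppend (single r) p).inv ≫ r ◁ m ≫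
      (Str.evalAppend (single r) (single q.eval)).hom) ≫ 𝟙 (r ≫ q.eval) ≫
        (Str.evalCons r q).hom = eqToHom (congrArg Str.eval (hs.trans (by rw [h]))) := by
  subst h hm hs
  rw [evalAppend_single, evalAppend_single_left]
  change 𝟙 _ ≫ ((Str.evalCons r p).inv ≫ r ◁ 𝟙 p.eval ≫ 𝟙 (r ≫ p.eval)) ≫ 𝟙 (r ≫ p.eval) ≫
    (Str.evalCons r p).hom = 𝟙 _
  simp

theorem evalMap_f_val {a b : B} (p : Str a b) :
    (Str.evalMap (f B) p).hom.val = eqToHom (congrArg Str.eval (eval_map_f p)) := by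
  induction p with
  | nil a => rfl
  | @cons a b c r p ih =>
    refine Eq.trans ?_ (single_conj r (eval_map_f p) ih (eval_eval_cons_single r (p.map (f B))))
    exact congrArg (fun i => i ≫ ((Str.evalAppend (single r)
      (Str.eval (B := St B) (p.map (f B)))).inv ≫ r ◁ (Str.evalMap (f B) p).hom.val ≫
        (Str.evalAppend (single r) (single p.eval)).hom) ≫ 𝟙 (r ≫ p.eval) ≫
          (Str.evalCons r p).hom) (evalCons_single_inv_val r (p.map (f B)))

theorem evalMap_f_inv_val {a b : B} (p : Str a b) :
    (Str.evalMap (f B) p).inv.val = eqToHom (congrArg Str.eval (eval_map_f p)).symm :=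
  have h : (Str.evalMap (f B) p).inv.val ≫ (Str.evalMap (f B) p).hom.val = 𝟙 p.eval :=
    congrArg Hom₂.val (Str.evalMap (f B) p).inv_hom_id
  eq_eqToHom_symm_of_comp_eq_id h _ (evalMap_f_val p)

/-- The left triangle identity. On 2-cells the composite conjugates by `evalMap` for `f`, whose
values in `B` are transports. -/
theorem map_f_comp_eStrict :
    (map (f B)).comp (eStrict (St B)) = StrictPseudofunctor.id (St B) := by
  refine strictPseudofunctor_ext (prelaxFunctor_ext (fun _ => rfl) (fun p => eval_map_f p) ?_)
  intro a b p q η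
  refine hom₂_eq_conj (eval_map_f p) (eval_map_f q) ?_
  exact congr_arg₂ (fun i j => i ≫ η.val ≫ j) (evalMap_f_val p) (evalMap_f_inv_val q)

end St

/-! ### Pasting with comparison isomorphisms in a bicategory -/

section Comparison

variable {K : Type u} [Bicategory.{w, v} K] {A B C A' B' C' : K}
  {eA : A' ⟶ A} {eB : B' ⟶ B} {eC : C' ⟶ C}

/-- Primes stand for strictifications, `eA`, `eB`, `eC` for the counit and `φ` for the comparisons.
With the comparisons of composites given by pasting, `φF` commutes past the whiskered 2-cell by
interchange and cancels. -/
theorem comparison_whiskerLeft {F : A ⟶ B} {G H : B ⟶ C} {F' : A' ⟶ B'} {G' H' : B' ⟶ C'}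
    {FG' FH' : A' ⟶ C'} (hG : FG' = F' ≫ G') (hH : FH' = F' ≫ H')
    (φF : F' ≫ eB ≅ eA ≫ F) (φG : G' ≫ eC ≅ eB ≫ G) (φH : H' ≫ eC ≅ eB ≫ H)
    (φFG : FG' ≫ eC ≅ eA ≫ F ≫ G) (φFH : FH' ≫ eC ≅ eA ≫ F ≫ H)
    (hFG : φFG.hom = eqToHom hG ▷ eC ≫ (α_ F' G' eC).hom ≫ F' ◁ φG.hom ≫ (α_ F' eB G).inv ≫
      φF.hom ▷ G ≫ (α_ eA F G).hom)
    (hFH : φFH.hom = eqToHom hH ▷ eC ≫ (α_ F' H' eC).hom ≫ F' ◁ φH.hom ≫ (α_ F' eB H).inv ≫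
      φF.hom ▷ H ≫ (α_ eA F H).hom)
    {α : G ⟶ H} {α' : G' ⟶ H'} (hα : α' ▷ eC = φG.hom ≫ eB ◁ α ≫ φH.inv) :
    φFG.hom ≫ eA ◁ F ◁ α ≫ φFH.inv = (eqToHom hG ≫ F' ◁ α' ≫ eqToHom hH.symm) ▷ eC := by
  subst hG hH
  rw [← Category.assoc, Iso.comp_inv_eq, hFG, hFH]
  simp only [eqToHom_refl, id_whiskerRight, Category.id_comp, Category.comp_id, Category.assoc,
    whisker_assoc, hα, whiskerLeft_comp, Iso.inv_hom_id_assoc, whiskerLeft_inv_hom_assoc]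
  rw [← associator_naturality_right, ← whisker_exchange_assoc]
  simp

theorem comparison_whiskerRight {F G : A ⟶ B} {H : B ⟶ C} {F' G' : A' ⟶ B'} {H' : B' ⟶ C'}
    {FH' GH' : A' ⟶ C'} (hF : FH' = F' ≫ H') (hG : GH' = G' ≫ H')
    (φF : F' ≫ eB ≅ eA ≫ F) (φG : G' ≫ eB ≅ eA ≫ G) (φH : H' ≫ eC ≅ eB ≫ H)
    (φFH : FH' ≫ eC ≅ eA ≫ F ≫ H) (φGH : GH' ≫ eC ≅ eA ≫ G ≫ H)
    (hFH : φFH.hom = eqToHom hF ▷ eC ≫ (α_ F' H' eC).hom ≫ F' ◁ φH.hom ≫ (α_ F' eB H).inv ≫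
      φF.hom ▷ H ≫ (α_ eA F H).hom)
    (hGH : φGH.hom = eqToHom hG ▷ eC ≫ (α_ G' H' eC).hom ≫ G' ◁ φH.hom ≫ (α_ G' eB H).inv ≫
      φG.hom ▷ H ≫ (α_ eA G H).hom)
    {α : F ⟶ G} {α' : F' ⟶ G'} (hα : α' ▷ eB = φF.hom ≫ eA ◁ α ≫ φG.inv) :
    φFH.hom ≫ eA ◁ α ▷ H ≫ φGH.inv = (eqToHom hF ≫ α' ▷ H' ≫ eqToHom hG.symm) ▷ eC := by
  subst hF hG
  rw [← Category.assoc, Iso.comp_inv_eq, hFH, hGH]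
  have h : α' ▷ (eB ≫ H) = (α_ _ _ _).inv ≫ (φF.hom ≫ eA ◁ α ≫ φG.inv) ▷ H ≫ (α_ _ _ _).hom := by
    rw [← hα]
    simp
  simp only [eqToHom_refl, id_whiskerRight, Category.id_comp, Category.comp_id, Category.assoc]
  rw [← associator_naturality_middle, associator_naturality_left_assoc, ← whisker_exchange_assoc, h]
  simp

/-- The 2-naturality square of the unit after whiskering with `eB`. The comparisons become
identities when restricted along `fA`, and `fA ≫ eA = 𝟙 A`, `fB ≫ eB = 𝟙 B` reduce both sides to `α`
up to transport. -/
theorem comparison_unit [Strict K] {fA : A ⟶ A'} {fB : B ⟶ B'} (hA : fA ≫ eA = 𝟙 A)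
    (hB : fB ≫ eB = 𝟙 B) {F G : A ⟶ B} {F' G' : A' ⟶ B'} (hF : F ≫ fB = fA ≫ F')
    (hG : G ≫ fB = fA ≫ G') (φF : F' ≫ eB ≅ eA ≫ F) (φG : G' ≫ eB ≅ eA ≫ G)
    {hF' : fA ≫ F' ≫ eB = fA ≫ eA ≫ F} {hG' : fA ≫ G' ≫ eB = fA ≫ eA ≫ G}
    (hφF : fA ◁ φF.hom = eqToHom hF') (hφG : fA ◁ φG.hom = eqToHom hG')
    {α : F ⟶ G} {α' : F' ⟶ G'} (hα : α' ▷ eB = φF.hom ≫ eA ◁ α ≫ φG.inv) :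
    (α ▷ fB ≫ eqToHom hG) ▷ eB = (eqToHom hF ≫ fA ◁ α') ▷ eB := by
  have h₁ : fA ◁ φG.inv = eqToHom hG'.symm := by
    rw [← cancel_epi (fA ◁ φG.hom), ← whiskerLeft_comp, Iso.hom_inv_id, hφG]
    simp
  have h₂ : α ▷ (fB ≫ eB) = eqToHom (by rw [hB]) ≫ α ▷ 𝟙 B ≫ eqToHom (by rw [hB]) :=
    whiskerRight_congr hB α
  have h₃ : (fA ≫ eA) ◁ α = eqToHom (by rw [hA]) ≫ 𝟙 A ◁ α ≫ eqToHom (by rw [hA]) :=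
    congr_whiskerLeft hA α
  have h₄ : (α ▷ fB) ▷ eB = (α_ _ _ _).hom ≫ α ▷ (fB ≫ eB) ≫ (α_ _ _ _).inv := by simp
  have h₅ : fA ◁ eA ◁ α = (α_ _ _ _).inv ≫ (fA ≫ eA) ◁ α ≫ (α_ _ _ _).hom := by simp
  rw [comp_whiskerRight, comp_whiskerRight, whisker_assoc, hα, h₄, h₂, whiskerLeft_comp,
    whiskerLeft_comp, hφF, h₁, h₅, h₃]
  simp [Strict.associator_eqToIso, Strict.leftUnitor_eqToIso, Strict.rightUnitor_eqToIso]

end Comparison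

/-! ### Icons that are transports -/

section Icons

variable {B : Type u₁} [Bicategory.{w₁, v₁} B] {C : Type u₂} [Bicategory.{w₂, v₂} C]

attribute [local instance] iconCategory

theorem icon_eq_eqToHom {F G : B ⥤ᵖ C} (α : IconHom F G) (h : F = G)
    (H : ∀ {a b : B} (f : a ⟶ b), HEq (α.app f) (𝟙 (G.map f))) : α = (eqToHom h : F ⟶ G) := by
  refine (icon_eq_conj h α (IconHom.id G) rfl H).trans ?_
  exact (congrArg _ (Category.id_comp _)).trans (Category.comp_id _)

theorem eqToHom_heq_id {X : Type*} [Category X] {x y : X} (h : x = y) :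
    HEq (eqToHom h) (𝟙 y) := by
  subst h
  rfl

theorem icon_conj_app {F F' G G' : B ⥤ᵖ C} (h : F = F') (β : F' ⟶ G')
    (h' : G' = G) {a b : B} (f : a ⟶ b) :
    HEq (IconHom.app (eqToHom h ≫ β ≫ eqToHom h' : F ⟶ G) f) (IconHom.app β f) := by
  subst h h'
  have key : (𝟙 F ≫ β ≫ 𝟙 G' : F ⟶ G') = β := by simp
  change HEq (IconHom.app (𝟙 F ≫ β ≫ 𝟙 G' : F ⟶ G') f) _
  rw [key]

end Icons

/-- `Str.evalMap_comp` in the shape of a component of a pasted icon: the identities come from the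
transports in right whiskering and vertical composition, and `HEq` absorbs the equality of strings.
-/
theorem Str.evalMap_comp_heq {B : Type u₁} [Bicategory.{w₁, v₁} B] {C : Type u₂}
    [Bicategory.{w₂, v₂} C] {D : Type u₃} [Bicategory.{w₃, v₃} D] (F : B ⥤ᵖ C) (G : C ⥤ᵖ D)
    {a b : B} (p : Str a b) {m : G.map (p.map F).eval ⟶ G.map (F.map p.eval)}
    (hm : m = G.map₂ (Str.evalMap F p).hom ≫ 𝟙 _) :
    HEq (Str.evalMap (F.comp G) p).hom ((Str.evalMap G (p.map F)).hom ≫ m ≫ 𝟙 _) := by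
  subst hm
  rw [Str.evalMap_comp]
  refine (eqToHom_comp_heq _ _).trans (heq_of_eq ?_)
  simp only [Category.comp_id]
  rfl

/-! ### Strictification of icons and 2-naturality of the unit -/

namespace BicatIcon

variable {B C D : BicatIcon.{w, max u v, u}}

/-- The strictification of a bicategory, as an object of `Icon`. -/
abbrev st (B : BicatIcon.{w, max u v, u}) : BicatIcon.{w, max u v, u} :=
  (strictification.{w, v, u} B).toBicatIcon

/-- The pseudofunctor `e`, as a 1-cell of `Icon`. -/
def counit (B : BicatIcon.{w, max u v, u}) : st.{w, v, u} B ⟶ B := St.e B.carrier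

/-- The pseudofunctor `f`, as a 1-cell of `Icon`. -/
def unit (B : BicatIcon.{w, max u v, u}) : B ⟶ st.{w, v, u} B := St.f B.carrier

/-- The 2-functor between strictifications induced by a pseudofunctor, as a 1-cell of `Icon`. -/
def stMap (F : B ⟶ C) : st.{w, v, u} B ⟶ st.{w, v, u} C := (St.map F).toPseudofunctor

/-- The invertible icon comparing `stMap F` with `F`. -/
def comparison (F : B ⟶ C) : stMap.{w, v, u} F ≫ counit C ≅ counit B ≫ F where
  hom := St.evalMapIcon F
  inv := St.evalMapIconInv F
  hom_inv_id := IconHom.ext_app fun {a b} p => by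
    change (Str.evalMap F p).hom ≫ (Str.evalMap F p).inv ≫ 𝟙 _ = 𝟙 _
    simp
  inv_hom_id := IconHom.ext_app fun {a b} p => by
    change (Str.evalMap F p).inv ≫ (Str.evalMap F p).hom ≫ 𝟙 _ = 𝟙 _
    simp

theorem whiskerRight_counit_injective {G H : B ⟶ st.{w, v, u} C} {α β : G ⟶ H}
    (h : α ▷ counit C = β ▷ counit C) : α = β :=
  St.whiskerRight_e_injective h

theorem exists_whiskerRight_counit_eq {G H : B ⟶ st.{w, v, u} C}
    (β : G ≫ counit C ⟶ H ≫ counit C) : ∃ α : G ⟶ H, α ▷ counit C = β :=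
  St.exists_whiskerRight_e_eq β

/-- The icon between strictifications induced by an icon. -/
noncomputable def stMap₂ {F G : B ⟶ C} (α : F ⟶ G) : stMap.{w, v, u} F ⟶ stMap.{w, v, u} G :=
  (exists_whiskerRight_counit_eq
    ((comparison F).hom ≫ counit B ◁ α ≫ (comparison G).inv)).choose

/-- As whiskering with `counit C` is injective, this determines `stMap₂ α`; the laws for `stMap₂`
are derived from it alone. -/
theorem stMap₂_whiskerRight_counit {F G : B ⟶ C} (α : F ⟶ G) :
    stMap₂.{w, v, u} α ▷ counit C = (comparison F).hom ≫ counit B ◁ α ≫ (comparison G).inv :=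
  (exists_whiskerRight_counit_eq
    ((comparison F).hom ≫ counit B ◁ α ≫ (comparison G).inv)).choose_spec

theorem stMap₂_id (F : B ⟶ C) : stMap₂.{w, v, u} (𝟙 F) = 𝟙 (stMap F) :=
  whiskerRight_counit_injective (by simp [stMap₂_whiskerRight_counit])

theorem stMap₂_comp {F G H : B ⟶ C} (α : F ⟶ G) (β : G ⟶ H) :
    stMap₂.{w, v, u} (α ≫ β) = stMap₂ α ≫ stMap₂ β :=
  whiskerRight_counit_injective (by simp [stMap₂_whiskerRight_counit])

theorem stMap_comp (F : B ⟶ C) (G : C ⟶ D) :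
    stMap.{w, v, u} (F ≫ G) = stMap F ≫ stMap G :=
  congrArg (fun H => H.toPseudofunctor) (St.map_comp F G)

/-- The pasting formula, which is `Str.evalMap_comp` read as an equation of icons. -/
theorem comparison_comp (F : B ⟶ C) (G : C ⟶ D) :
    (comparison.{w, v, u} (F ≫ G)).hom = eqToHom (stMap_comp F G) ▷ counit D ≫
      (α_ (stMap F) (stMap G) (counit D)).hom ≫ stMap F ◁ (comparison G).hom ≫
      (α_ (stMap F) (counit C) G).inv ≫ (comparison F).hom ▷ G ≫ (α_ (counit B) F G).hom := by
  -- `γ` is the comparison of `F` whiskered by `G`, with the associators written as transports. It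
  -- is kept opaque so that only its components, computed in `hγ'`, are used.
  obtain ⟨γ, hγ⟩ : ∃ γ, γ = eqToHom (Strict.assoc (stMap.{w, v, u} F) (counit C) G).symm ≫
    (comparison F).hom ▷ G ≫ eqToHom (Strict.assoc (counit B) F G) := ⟨_, rfl⟩
  have hγ' : ∀ {a b : St B.carrier} (p : a ⟶ b),
      IconHom.app γ p = G.map₂ (Str.evalMap F p).hom ≫ 𝟙 _ := fun p => by
    rw [hγ]
    exact eq_of_heq (icon_conj_app _ _ _ p)
  have h : stMap.{w, v, u} (F ≫ G) ≫ counit D = stMap F ≫ stMap G ≫ counit D := by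
    rw [stMap_comp, Strict.assoc]
  have key : (comparison.{w, v, u} (F ≫ G)).hom =
      eqToHom h ≫ (stMap F ◁ (comparison G).hom ≫ γ) ≫ eqToHom rfl := by
    refine icon_eq_conj h _ _ rfl fun p => ?_
    exact Str.evalMap_comp_heq F G p (hγ' p)
  rw [key, hγ]
  simp [Strict.associator_eqToIso]

theorem stMap₂_whiskerLeft (F : B ⟶ C) {G H : C ⟶ D} (α : G ⟶ H) :
    stMap₂.{w, v, u} (F ◁ α) = eqToHom (stMap_comp F G) ≫ stMap F ◁ stMap₂ α ≫
      eqToHom (stMap_comp F H).symm :=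
  whiskerRight_counit_injective ((stMap₂_whiskerRight_counit _).trans
    (comparison_whiskerLeft _ _ (comparison F) (comparison G) (comparison H) _ _
      (comparison_comp F G) (comparison_comp F H) (stMap₂_whiskerRight_counit α)))

theorem stMap₂_whiskerRight {F G : B ⟶ C} (α : F ⟶ G) (H : C ⟶ D) :
    stMap₂.{w, v, u} (α ▷ H) = eqToHom (stMap_comp F H) ≫ stMap₂ α ▷ stMap H ≫
      eqToHom (stMap_comp G H).symm :=
  whiskerRight_counit_injective ((stMap₂_whiskerRight_counit _).trans
    (comparison_whiskerRight _ _ (comparison F) (comparison G) (comparison H) _ _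
      (comparison_comp F H) (comparison_comp G H) (stMap₂_whiskerRight_counit α)))

theorem unit_counit (B : BicatIcon.{w, max u v, u}) : unit.{w, v, u} B ≫ counit B = 𝟙 B :=
  St.f_comp_e

theorem unit_naturality (F : B ⟶ C) : F ≫ unit.{w, v, u} C = unit B ≫ stMap F :=
  St.comp_f F

/-- Restriction along the unit evaluates the comparison at strings of length one, where `evalMap` is
an identity. -/
theorem unit_whiskerLeft_comparison (F : B ⟶ C) :
    ∃ h, unit.{w, v, u} B ◁ (comparison F).hom = eqToHom h := by
  have h : unit.{w, v, u} B ≫ stMap F ≫ counit C = unit B ≫ counit B ≫ F := by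
    rw [← Strict.assoc, ← unit_naturality, Strict.assoc, unit_counit, Strict.comp_id,
      ← Strict.assoc, unit_counit, Strict.id_comp]
  exact ⟨h, icon_eq_eqToHom _ h fun r => heq_of_eq (Str.evalMap_single F r)⟩

theorem unit_naturality₂ {F G : B ⟶ C} (α : F ⟶ G) :
    α ▷ unit.{w, v, u} C ≫ eqToHom (unit_naturality G) =
      eqToHom (unit_naturality F) ≫ unit B ◁ stMap₂ α := by
  obtain ⟨_, hF⟩ := unit_whiskerLeft_comparison.{w, v, u} F
  obtain ⟨_, hG⟩ := unit_whiskerLeft_comparison.{w, v, u} G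
  exact whiskerRight_counit_injective (comparison_unit (unit_counit B) (unit_counit C) _ _
    (comparison F) (comparison G) hF hG (stMap₂_whiskerRight_counit α))

end BicatIcon

/-! ### Passage to `Gray_icon` and the 2-adjunction -/

namespace GrayIcon

/-- The 2-cells of `Gray_icon` and their composition are those of `Icon`; only the transports have
to be translated, along equalities of 2-functors instead of pseudofunctors. -/
theorem eq_conj_of_toHom {A B : GrayIcon.{w, v, u}} {F F' G G' : A ⟶ B} (h : F = F')
    (h' : G' = G) {α : F ⟶ G} {β : F' ⟶ G'}
    (H : (α : toHom F ⟶ toHom G) = (eqToHom (congrArg toHom h) : toHom F ⟶ toHom F') ≫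
      (β : toHom F' ⟶ toHom G') ≫ (eqToHom (congrArg toHom h') : toHom G' ⟶ toHom G)) :
    α = eqToHom h ≫ β ≫ eqToHom h' := by
  rw [toHom_eqToHom, toHom_eqToHom]
  exact H

theorem comp_eqToHom_eq_of_toHom {A B : GrayIcon.{w, v, u}} {F F' G G' : A ⟶ B} (h : F = F')
    (h' : G = G') {α : F ⟶ G} {β : F' ⟶ G'}
    (H : (α : toHom F ⟶ toHom G) ≫ (eqToHom (congrArg toHom h') : toHom G ⟶ toHom G') =
      (eqToHom (congrArg toHom h) : toHom F ⟶ toHom F') ≫ (β : toHom F' ⟶ toHom G')) :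
    α ≫ eqToHom h' = eqToHom h ≫ β := by
  rw [toHom_eqToHom, toHom_eqToHom]
  exact H

theorem comparison_strict {A B : GrayIcon.{w, max u v, u}} (F : A ⟶ B) :
    ∃ h, (BicatIcon.comparison.{w, v, u} (toHom F)).hom = eqToHom h := by
  have h : BicatIcon.stMap.{w, v, u} (toHom F) ≫ BicatIcon.counit B.toBicatIcon =
      BicatIcon.counit A.toBicatIcon ≫ toHom F :=
    congrArg (fun H => H.toPseudofunctor) (St.map_comp_eStrict F)
  refine ⟨h, icon_eq_eqToHom _ h fun {a b} p => ?_⟩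
  obtain ⟨h', hp⟩ := Str.evalMap_eq_eqToIso F p
  exact (heq_of_eq (congrArg Iso.hom hp)).trans (eqToHom_heq_id h')

/-- The 2-functor between strictifications induced by a pseudofunctor, as a 1-cell of
`Gray_icon`. -/
def stMap {B C : BicatIcon.{w, max u v, u}} (F : B ⟶ C) :
    strictification.{w, v, u} B ⟶ strictification.{w, v, u} C := St.map F

/-- The icon between strictifications induced by an icon, as a 2-cell of `Gray_icon`. -/
noncomputable def stMap₂ {B C : BicatIcon.{w, max u v, u}} {F G : B ⟶ C} (α : F ⟶ G) :
    stMap.{w, v, u} F ⟶ stMap.{w, v, u} G := BicatIcon.stMap₂ α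

theorem stMap_comp {B C D : BicatIcon.{w, max u v, u}} (F : B ⟶ C) (G : C ⟶ D) :
    stMap.{w, v, u} (F ≫ G) = stMap F ≫ stMap G := St.map_comp F G

theorem stMap₂_whiskerLeft {B C D : BicatIcon.{w, max u v, u}} (F : B ⟶ C) {G H : C ⟶ D}
    (α : G ⟶ H) : stMap₂.{w, v, u} (F ◁ α) = eqToHom (stMap_comp F G) ≫ stMap F ◁ stMap₂ α ≫
      eqToHom (stMap_comp F H).symm :=
  eq_conj_of_toHom _ _ (BicatIcon.stMap₂_whiskerLeft F α)

theorem stMap₂_whiskerRight {B C D : BicatIcon.{w, max u v, u}} {F G : B ⟶ C} (α : F ⟶ G)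
    (H : C ⟶ D) : stMap₂.{w, v, u} (α ▷ H) = eqToHom (stMap_comp F H) ≫ stMap₂ α ▷ stMap H ≫
      eqToHom (stMap_comp G H).symm :=
  eq_conj_of_toHom _ _ (BicatIcon.stMap₂_whiskerRight α H)

/-- The strictification 2-functor. -/
noncomputable def st : TwoFunctorExtending strictification.{w, v, u} where
  map F := stMap F
  map₂ α := stMap₂ α
  map_id _ := St.map_id
  map_comp F G := stMap_comp F G
  map₂_id F := BicatIcon.stMap₂_id F
  map₂_comp α β := BicatIcon.stMap₂_comp α β
  map₂_whisker_left F _ _ α := stMap₂_whiskerLeft F α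
  map₂_whisker_right α H := stMap₂_whiskerRight α H

/-- The 2-functor `e` on a 2-category, as a 1-cell of `Gray_icon`. -/
def counitApp (A : GrayIcon.{w, max u v, u}) : strictification.{w, v, u} A.toBicatIcon ⟶ A :=
  St.eStrict A.carrier

theorem counitApp_naturality {A B : GrayIcon.{w, max u v, u}} (F : A ⟶ B) :
    stMap.{w, v, u} (toHom F) ≫ counitApp B = counitApp A ≫ F := St.map_comp_eStrict F

/-- For 2-functors the comparisons are transports, and then the defining equation of `stMap₂ α` is
itself the 2-naturality of the counit. -/
theorem counitApp_naturality₂ {A B : GrayIcon.{w, max u v, u}} {F G : A ⟶ B} (α : F ⟶ G) :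
    stMap₂.{w, v, u} (F := toHom F) (G := toHom G) α ▷ counitApp B ≫
        eqToHom (counitApp_naturality G) =
      eqToHom (counitApp_naturality F) ≫ counitApp A ◁ α := by
  obtain ⟨_, hF⟩ := comparison_strict.{w, v, u} F
  obtain ⟨_, hG⟩ := comparison_strict.{w, v, u} G
  have h := BicatIcon.stMap₂_whiskerRight_counit.{w, v, u} (F := toHom F) (G := toHom G) α
  rw [← Category.assoc, Iso.eq_comp_inv, hF, hG] at h
  exact comp_eqToHom_eq_of_toHom _ _ h

/-- The unit `1 ⇒ i ∘ st`. -/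
noncomputable def unit : TwoNatTrans (StrictPseudofunctor.id BicatIcon.{w, max u v, u})
    (st.{w, v, u}.toTwoFunctor.comp grayInclusion) where
  app B := BicatIcon.unit B
  naturality F := BicatIcon.unit_naturality F
  naturality₂ α := BicatIcon.unit_naturality₂ α

/-- The counit `st ∘ i ⇒ 1`. -/
noncomputable def counit : TwoNatTrans (grayInclusion.comp st.{w, v, u}.toTwoFunctor)
    (StrictPseudofunctor.id GrayIcon.{w, max u v, u}) where
  app A := counitApp A
  naturality F := counitApp_naturality F
  naturality₂ α := counitApp_naturality₂ α

end GrayIcon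

theorem theorem4p1 :
    ∃ (st : TwoFunctorExtending strictification.{w, v, u})
      (adj : TwoAdjunction st.toTwoFunctor grayInclusion.{w, max u v, u}),
      (∀ B : BicatIcon.{w, max u v, u}, adj.unit.app B = St.f B.carrier) ∧
      (∀ A : GrayIcon.{w, max u v, u},
        grayInclusion.map (adj.counit.app A) = St.e A.carrier) := by
  -- The remaining triangle identity, at a 2-category `A`, is `f` followed by `e` on `A`; it is an
  -- instance of `unit_counit`, valid for all bicategories.
  refine ⟨GrayIcon.st, ⟨GrayIcon.unit, GrayIcon.counit, fun _ => St.map_f_comp_eStrict, fun A => ?_⟩,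
    fun _ => rfl, fun _ => rfl⟩
  exact BicatIcon.unit_counit A.toBicatIcon
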